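/- \textbf{Setting.} Let $\mathcal V$ be a finite dimensional real vector space with a positive semi-definite symmetric bilinear form $(\cdot,\cdot)$, and let $R\subseteq\mathcal V$ be an extended affine root system of type $A_1$. Write $R^\times=\{\alpha\in R:(\alpha,\alpha)\neq0\}$, let $\mathcal V^0$ be the radical of the form and $\nu=\dim\mathcal V^0$. Fix a complement $\dot{\mathcal V}$ of $\mathcal V^0$ in $\mathcal V$, a vector $\alpha_1\in\dot{\mathcal V}$ and a semilattice $S$ in $\mathcal V^0$ (a discrete spanning subset with $0\in S$ and $S\pm2S\subseteq S$) such that $$R=(S+S)\cup(\pm\alpha_1+S),$$ and a basis $\{\sigma_1,\dots,\sigma_\nu\}\subseteq S$ of $\mathcal V^0$ with $\Lambda:=\mathbb Z\text{-span}(S)=\sum_i\mathbb Z\sigma_i$. \emph{Integral collections.} For $J\subseteq\{1,\dots,\nu\}$ put $\tau_J=\sum_{j\in J}\sigma_j$. Let $\mathrm{supp}(S)=\{J:\tau_J\in S\}$ (so that $S=\bigcup_{J\in\mathrm{supp}(S)}(\tau_J+2\Lambda)$) and $\mathrm{Esupp}(S)=\{J\in\mathrm{supp}(S):|J|\ge3\}$.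 For $r<s$ let $\delta(r,s)=1$ if $\{r,s\}\in\mathrm{supp}(S)$ and $\delta(r,s)=2$ otherwise; let $\delta(J,r,s)=1$ if $\{r,s\}\subsetneq J$ and $\delta(J,r,s)=0$ otherwise. A collection $\tilde\epsilon=\{\epsilon_J\}_{J\in\mathrm{Esupp}(S)}$ with $\epsilon_J\in\{0,1\}$ is \emph{integral} if $\frac1{\delta(r,s)}\sum_{J\in\mathrm{Esupp}(S)}\delta(J,r,s)\epsilon_J\in\mathbb Z$ for all $1\le r<s\le\nu$. \emph{The groups.} Let $\tilde{\mathcal V}=\mathcal V\oplus(\mathcal V^0)^*$, with the symmetric form that extends $(\cdot,\cdot)$, vanishes on $\dot{\mathcal V}\times(\mathcal V^0)^*$ and on $(\mathcal V^0)^*\times(\mathcal V^0)^*$, and is the natural pairing on $\mathcal V^0\times(\mathcal V^0)^*$. For $\alpha\in R^\times$ let $w_\alpha(u)=u-\frac{2(u,\alpha)}{(\alpha,\alpha)}\alpha$ be the corresponding reflection of $\tilde{\mathcal V}$, and let $\mathcal W$ be the group generated by all $w_\alpha$, $\alpha\in R^\times$ (the extended affine Weyl group). Let $\hat{\mathcal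 W}$ be the group with generators $\hat w_\alpha$, $\alpha\in R^\times$, and relations $\hat w_\alpha^2=1$ and $\hat w_\alpha\hat w_\beta\hat w_\alpha=\hat w_{w_\alpha(\beta)}$ for $\alpha,\beta\in R^\times$, and let $\psi:\hat{\mathcal W}\to\mathcal W$ be the epimorphism with $\psi(\hat w_\alpha)=w_\alpha$. \emph{The elements.} Put $\hat t_r=\hat w_{\alpha_1+\sigma_r}\hat w_{\alpha_1}$, and for $J\subseteq\{1,\dots,\nu\}$ $$\hat z_J=\begin{cases}\hat w_{\alpha_1}\hat w_{\alpha_1+\tau_J}\prod_{r\in J}\hat t_r&\text{if }J\in\mathrm{supp}(S)\ (\text{product with }r\text{ increasing}),\\ \hat t_r^{-1}\hat t_s^{-1}\hat t_r\hat t_s&\text{if }J=\{r,s\}\notin\mathrm{supp}(S),\ r<s,\\ 1&\text{otherwise.}\end{cases}$$ Let $\hat Z=\langle\hat z_J: J\subseteq\{1,\dots,\nu\}\rangle$. For integers $\tilde m=\{m_{r,s}\}_{1\le r<s\le\nu}$ and $\tilde\epsilon=\{\epsilon_J\}_{J\in\mathrm{Esupp}(S)}$, $\epsilon_J\in\{0,1\}$,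 put $$\hat u(\tilde m,\tilde\epsilon)=\prod_{1\le r<s\le\nu}\hat z_{\{r,s\}}^{m_{r,s}}\prod_{J\in\mathrm{Esupp}(S)}\hat z_J^{\epsilon_J}.$$ \textbf{Proposition.} The subgroup $\hat Z$ is contained in the center of $\hat{\mathcal W}$, and the following hold. (i) $\ker\psi\subseteq\hat Z$. (ii) For $\hat u\in\hat Z$ the following are equivalent: (a) $\hat u\in\ker\psi$; (b) $\hat u^2=1$; (c) $\hat u$ has finite order; (d) $\hat u=\hat u(\tilde m,\tilde\epsilon)$ for some integral collection $\tilde\epsilon$ and the integers $$m_{r,s}=-\frac1{\delta(r,s)}\sum_{J\in\mathrm{Esupp}(S)}\delta(J,r,s)\epsilon_J\qquad(1\le r<s\le\nu).\qquad(*)$$ (iii) The assignment $\tilde\epsilon\mapsto\hat u(\tilde m,\tilde\epsilon)$, with $\tilde m$ given by $(*)$, is a bijection from the set of integral collections for $S$ onto $\ker\psi$. -/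

import Mathlib

noncomputable section

open Module

namespace EAWG

/-! ### Semilattices -/

/-- A semilattice in a finite dimensional real vector space `W`: a discrete spanning set that
contains `0` and satisfies `S ± 2S ⊆ S`. -/
structure IsSemilattice {W : Type*} [AddCommGroup W] [Module ℝ W] [TopologicalSpace W]
    (S : Set W) : Prop where
  zero_mem : (0 : W) ∈ S
  add_two_smul_mem : ∀ s ∈ S, ∀ t ∈ S, s + (2 : ℤ) • t ∈ S
  sub_two_smul_mem : ∀ s ∈ S, ∀ t ∈ S, s - (2 : ℤ) • t ∈ S
  span_eq_top : Submodule.span ℝ S = ⊤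
  discrete : IsDiscrete S

section Semilattice

variable {W : Type*} [AddCommGroup W] {ν : ℕ}

/-- The element `τ_J`, the sum of the basis vectors `σ_j` over `j ∈ J`. -/
def tau (σ : Fin ν → W) (J : Finset (Fin ν)) : W := ∑ j ∈ J, σ j

/-- The supporting class of `S` with respect to `σ`: the sets `J` with `τ_J ∈ S`. For a semilattice
`S` and a `ℤ`-basis `σ` of its `ℤ`-span that lies in `S`, it is the unique family of sets `J` for
which `S` is the union of the cosets `τ_J + 2Λ`; see `eq_supp_iff` below. -/
def supp (S : Set W) (σ : Fin ν → W) : Set (Finset (Fin ν)) := {J | tau σ J ∈ S}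

theorem IsSemilattice.add_two_smul_span_mem [Module ℝ W] [TopologicalSpace W] {S : Set W}
    (hS : IsSemilattice S) {l : W} (hl : l ∈ Submodule.span ℤ S) :
    ∀ s ∈ S, s + (2 : ℤ) • l ∈ S := by
  suffices h : ∀ s ∈ S, s + (2 : ℤ) • l ∈ S ∧ s - (2 : ℤ) • l ∈ S from fun s hs => (h s hs).1
  rw [← Submodule.mem_toAddSubgroup, Submodule.span_int_eq_addSubgroupClosure] at hl
  induction hl using AddSubgroup.closure_induction with
  | mem t ht => exact fun s hs => ⟨hS.add_two_smul_mem s hs t ht, hS.sub_two_smul_mem s hs t ht⟩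
  | zero => exact fun s hs => by simpa using hs
  | add x y _ _ hx hy =>
    intro s hs
    rw [smul_add, ← add_assoc, ← sub_sub]
    exact ⟨(hy _ (hx s hs).1).1, (hy _ (hx s hs).2).2⟩
  | neg x _ hx =>
    intro s hs
    rw [smul_neg, ← sub_eq_add_neg, sub_neg_eq_add]
    exact ⟨(hx s hs).2, (hx s hs).1⟩

/-- The support is the unique family `P` for which `S` is the union of the `τ_J + 2Λ`, `J ∈ P`. -/
theorem eq_supp_iff [Module ℝ W] [TopologicalSpace W] {S : Set W} (hS : IsSemilattice S)
    (σ : Basis (Fin ν) ℝ W) (hσ : Submodule.span ℤ S = Submodule.span ℤ (Set.range σ))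
    (P : Set (Finset (Fin ν))) :
    P = supp S σ ↔
      S = ⋃ J ∈ P, {v | ∃ l ∈ Submodule.span ℤ S, v = tau σ J + (2 : ℤ) • l} := by
  classical
  have key : ∀ J K : Finset (Fin ν), ∀ l ∈ Submodule.span ℤ S,
      tau σ J = tau σ K + (2 : ℤ) • l → J = K := by
    intro J K l hl h
    rw [hσ, Submodule.mem_span_range_iff_exists_fun] at hl
    obtain ⟨c, rfl⟩ := hl
    have hrep : ∀ L : Finset (Fin ν), ∀ i, σ.repr (tau σ L) i = if i ∈ L then 1 else 0 := by
      intro L i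
      simp [tau, Finsupp.single_apply]
    have hc : ∀ i, σ.repr (∑ j, c j • σ j) i = (c i : ℝ) := by
      intro i
      simp [Finsupp.single_apply]
    ext i
    have hi := congrArg (fun v => σ.repr v i) h
    simp only [map_add, Finsupp.add_apply, hrep, map_zsmul, Finsupp.smul_apply, hc] at hi
    by_cases h1 : i ∈ J <;> by_cases h2 : i ∈ K <;> simp only [h1, h2, if_true, if_false] at hi ⊢
    · have : (1 : ℤ) = 2 * c i := by
        have h3 : (1 : ℝ) = 2 * (c i : ℝ) := by simpa using hi
        exact_mod_cast h3
      omega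
    · have : (0 : ℤ) = 1 + 2 * c i := by
        have h3 : (0 : ℝ) = 1 + 2 * (c i : ℝ) := by simpa using hi
        exact_mod_cast h3
      omega
  constructor
  · rintro rfl
    ext v
    simp only [Set.mem_iUnion, Set.mem_ofPred_eq]
    constructor
    · intro hv
      have hv' : v ∈ Submodule.span ℤ S := Submodule.subset_span hv
      rw [hσ, Submodule.mem_span_range_iff_exists_fun] at hv'
      obtain ⟨c, hc⟩ := hv'
      have hl : ∑ i, (c i / 2) • σ i ∈ Submodule.span ℤ S := by
        rw [hσ]
        exact Submodule.sum_mem _ fun i _ =>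
          Submodule.smul_mem _ _ (Submodule.subset_span ⟨i, rfl⟩)
      have hveq : v = tau σ (Finset.univ.filter fun i => c i % 2 = 1)
          + (2 : ℤ) • ∑ i, (c i / 2) • σ i := by
        rw [← hc, tau, Finset.sum_filter, Finset.smul_sum, ← Finset.sum_add_distrib]
        refine Finset.sum_congr rfl fun i _ => ?_
        rw [smul_smul]
        rcases Int.emod_two_eq_zero_or_one (c i) with h | h
        · rw [if_neg (by omega), zero_add]
          congr 1
          omega
        · rw [if_pos h]
          nth_rewrite 2 [← one_smul ℤ (σ i)]
          rw [← add_smul]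
          congr 1
          omega
      refine ⟨_, ?_, _, hl, hveq⟩
      have := hS.add_two_smul_span_mem (Submodule.neg_mem _ hl) v hv
      rwa [hveq, smul_neg, add_neg_cancel_right] at this
    · rintro ⟨J, hJ, l, hl, rfl⟩
      exact hS.add_two_smul_span_mem hl _ hJ
  · intro h
    ext J
    constructor
    · intro hJ
      change tau σ J ∈ S
      rw [h]
      simp only [Set.mem_iUnion]
      exact ⟨J, hJ, 0, Submodule.zero_mem _, by simp⟩
    · intro hJ
      have hJ' : tau σ J ∈ S := hJ
      rw [h] at hJ'
      simp only [Set.mem_iUnion] at hJ'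
      obtain ⟨K, hK, l, hl, e⟩ := hJ'
      rwa [key J K l hl e]

/-- The essential support: the members of the support with at least three elements. -/
def Esupp (S : Set W) (σ : Fin ν → W) : Set (Finset (Fin ν)) := {J | J ∈ supp S σ ∧ 3 ≤ J.card}

/-- The pairs `(r, s)` with `r < s`. -/
abbrev Pairs (ν : ℕ) : Type := {p : Fin ν × Fin ν // p.1 < p.2}

open Classical in
/-- `δ(r,s)` is `1` if `{r,s}` is in the support and `2` otherwise. -/
def delta (S : Set W) (σ : Fin ν → W) (p : Pairs ν) : ℕ :=
  if ({p.1.1, p.1.2} : Finset (Fin ν)) ∈ supp S σ then 1 else 2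

/-- `δ(J,r,s)` is `1` if `{r,s}` is a proper subset of `J` and `0` otherwise. -/
def deltaJ (J : Finset (Fin ν)) (p : Pairs ν) : ℕ :=
  if ({p.1.1, p.1.2} : Finset (Fin ν)) ⊂ J then 1 else 0

/-- Collections `(ε_J)` of elements of `{0,1}`, indexed by the essential support. -/
abbrev Collection (S : Set W) (σ : Fin ν → W) : Type := Esupp S σ → Fin 2

open Classical in
/-- The rational number `(1 / δ(r,s)) * ∑_J δ(J,r,s) ε_J`, with `J` in the essential support. -/
def integralSum (S : Set W) (σ : Fin ν → W) (ε : Collection S σ) (p : Pairs ν) : ℚ :=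
  (1 / (delta S σ p : ℚ)) * ∑ J : Esupp S σ, (deltaJ J.1 p : ℚ) * ((ε J : ℕ) : ℚ)

/-- Integral collections: all the numbers `integralSum S σ ε p` are integers. -/
def IsIntegralCollection (S : Set W) (σ : Fin ν → W) (ε : Collection S σ) : Prop :=
  ∀ p : Pairs ν, ∃ k : ℤ, (k : ℚ) = integralSum S σ ε p

/-- The integers `m_{r,s} = - (1 / δ(r,s)) * ∑_J δ(J,r,s) ε_J` of an integral collection; the
floor is needed only to have a value for the other collections, see `mOf_cast`. -/
def mOf (S : Set W) (σ : Fin ν → W) (ε : Collection S σ) (p : Pairs ν) : ℤ :=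
  ⌊- integralSum S σ ε p⌋

theorem mOf_cast {S : Set W} {σ : Fin ν → W} {ε : Collection S σ}
    (hε : IsIntegralCollection S σ ε) (p : Pairs ν) :
    (mOf S σ ε p : ℚ) = - integralSum S σ ε p := by
  obtain ⟨k, hk⟩ := hε p
  rw [mOf, ← hk, ← Int.cast_neg, Int.floor_intCast]

end Semilattice

/-! ### Extended affine root systems -/

/-- The elements of `T` that are non-isotropic for the form `b`. -/
def nonIsotropic {V : Type*} [AddCommGroup V] [Module ℝ V] (b : LinearMap.BilinForm ℝ V)
    (T : Set V) : Set V := {α | α ∈ T ∧ b α α ≠ 0}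

/-- An extended affine root system belonging to `(V, form)`. -/
structure EARS (V : Type*) [AddCommGroup V] [Module ℝ V] [TopologicalSpace V] where
  nontrivial : Nontrivial V
  form : LinearMap.BilinForm ℝ V
  form_symm : ∀ v w, form v w = form w v
  form_nonneg : ∀ v, 0 ≤ form v v
  roots : Set V
  zero_mem : (0 : V) ∈ roots
  neg_mem : ∀ α ∈ roots, -α ∈ roots
  span_eq_top : Submodule.span ℝ roots = ⊤
  two_smul_notMem : ∀ α ∈ nonIsotropic form roots, (2 : ℝ) • α ∉ roots
  discrete : IsDiscrete roots
  string : ∀ α ∈ nonIsotropic form roots, ∀ β ∈ roots, ∃ d u : ℕ,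
    (∀ n : ℤ, β + n • α ∈ roots ↔ -(d : ℤ) ≤ n ∧ n ≤ (u : ℤ)) ∧
      2 * form β α / form α α = (d : ℝ) - (u : ℝ)
  irreducible : ∀ R₁ R₂ : Set V, nonIsotropic form roots = R₁ ∪ R₂ →
    (∀ α ∈ R₁, ∀ β ∈ R₂, form α β = 0) → R₁ = ∅ ∨ R₂ = ∅
  nonisolated : ∀ σ ∈ roots, form σ σ = 0 → ∃ α ∈ nonIsotropic form roots, α + σ ∈ roots

section Reflections

variable {E : Type*} [AddCommGroup E] [Module ℝ E]

/-- The orthogonal group of a bilinear form. -/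
def orthogonalGroup (I : LinearMap.BilinForm ℝ E) : Subgroup (E ≃ₗ[ℝ] E) where
  carrier := {g | ∀ u v, I (g u) (g v) = I u v}
  one_mem' := fun _ _ => rfl
  mul_mem' := fun {g h} hg hh u v => by
    simp only [Set.mem_ofPred_eq, LinearEquiv.mul_apply] at *
    rw [hg, hh]
  inv_mem' := fun {g} hg u v => by
    have := hg (g⁻¹ u) (g⁻¹ v)
    rw [← LinearEquiv.mul_apply, ← LinearEquiv.mul_apply, mul_inv_cancel] at this
    exact this.symm

/-- The reflection `u ↦ u - (2 I(u,a) / I(a,a)) a` in a non-isotropic vector `a`. -/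
def refl (I : LinearMap.BilinForm ℝ E) (a : E) (ha : I a a ≠ 0) : E ≃ₗ[ℝ] E :=
  Module.reflection (x := a) (f := (2 / I a a) • LinearMap.flip I a) (by
    simp only [LinearMap.smul_apply, LinearMap.flip_apply, smul_eq_mul]
    field_simp)

theorem refl_apply (I : LinearMap.BilinForm ℝ E) (a : E) (ha : I a a ≠ 0) (u : E) :
    refl I a ha u = u - (2 * I u a / I a a) • a := by
  rw [refl, Module.reflection_apply]
  simp only [LinearMap.smul_apply, LinearMap.flip_apply, smul_eq_mul]
  congr 2
  ring

theorem refl_mem_orthogonalGroup (I : LinearMap.BilinForm ℝ E) (hI : ∀ u v, I u v = I v u)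
    (a : E) (ha : I a a ≠ 0) : refl I a ha ∈ orthogonalGroup I := by
  intro u v
  simp only [refl_apply, map_sub, map_smul, LinearMap.sub_apply, LinearMap.smul_apply, smul_eq_mul]
  rw [hI a v]
  field_simp
  ring

end Reflections

namespace EARS

variable {V : Type*} [AddCommGroup V] [Module ℝ V] [TopologicalSpace V] (R : EARS V)

/-- The radical `V⁰` of the form. -/
abbrev radical : Submodule ℝ V := LinearMap.ker R.form

/-- The non-isotropic roots, as a type. -/
abbrev NonIso : Type _ := {α : V // α ∈ nonIsotropic R.form R.roots}

theorem form_add_radical (v : V) (s : R.radical) :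
    R.form (v + s) (v + s) = R.form v v := by
  have h1 : R.form (s : V) = 0 := s.2
  have h2 : R.form v (s : V) = 0 := by rw [R.form_symm, h1]; rfl
  simp [h1, h2]

/-- The underlying space `V ⊕ (V⁰)*` of the hyperbolic extension. -/
abbrev HypExt : Type _ := V × Dual ℝ R.radical

variable {R} {C : Submodule ℝ V}

/-- The form on the hyperbolic extension determined by a complement `C` of the radical: it extends
the form of `V`, vanishes on `C × (V⁰)*` and on `(V⁰)* × (V⁰)*`, and is the natural pairing on
`V⁰ × (V⁰)*`. -/
def extForm (hC : IsCompl C R.radical) : LinearMap.BilinForm ℝ R.HypExt :=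
  LinearMap.mk₂ ℝ
    (fun u v => R.form u.1 v.1 + v.2 (Submodule.projectionOnto R.radical C hC.symm u.1)
      + u.2 (Submodule.projectionOnto R.radical C hC.symm v.1))
    (fun u u' v => by simp; ring) (fun c u v => by simp; ring)
    (fun u v v' => by simp; ring) (fun c u v => by simp; ring)

theorem extForm_apply (hC : IsCompl C R.radical) (u v : R.HypExt) :
    extForm hC u v = R.form u.1 v.1
      + v.2 (Submodule.projectionOnto R.radical C hC.symm u.1)
      + u.2 (Submodule.projectionOnto R.radical C hC.symm v.1) := rfl

theorem extForm_symm (hC : IsCompl C R.radical) (u v : R.HypExt) :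
    extForm hC u v = extForm hC v u := by
  rw [extForm_apply, extForm_apply, R.form_symm]; ring

/-- The reflection `w_α` of the hyperbolic extension, for a non-isotropic root `α`. -/
def w (hC : IsCompl C R.radical) (α : R.NonIso) : R.HypExt ≃ₗ[ℝ] R.HypExt :=
  refl (extForm hC) (α.1, 0) (by simpa [extForm_apply] using α.2.2)

/-- The extended affine Weyl group: the group generated by the reflections `w_α`. -/
def weylGroup (hC : IsCompl C R.radical) : Subgroup (R.HypExt ≃ₗ[ℝ] R.HypExt) :=
  Subgroup.closure (Set.range (w hC))

theorem weylGroup_le_orthogonalGroup (hC : IsCompl C R.radical) :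
    weylGroup hC ≤ orthogonalGroup (extForm hC) := by
  rw [weylGroup, Subgroup.closure_le]
  rintro _ ⟨α, rfl⟩
  exact refl_mem_orthogonalGroup _ (extForm_symm hC) _ _

variable (R) in
/-- The relations `ŵ_α² = 1`, and `ŵ_α ŵ_β ŵ_α = ŵ_γ` for `γ = w_α(β)`. -/
def relations : Set (FreeGroup R.NonIso) :=
  {x | ∃ α : R.NonIso, x = FreeGroup.of α ^ 2} ∪
  {x | ∃ α β γ : R.NonIso,
    γ.1 = β.1 - (2 * R.form β.1 α.1 / R.form α.1 α.1) • α.1 ∧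
    x = FreeGroup.of α * FreeGroup.of β * FreeGroup.of α * (FreeGroup.of γ)⁻¹}

variable (R) in
/-- The group `Ŵ` defined by the presentation by conjugation. -/
abbrev WHat : Type _ := PresentedGroup R.relations

/-- The generator `ŵ_α` of `Ŵ`. -/
def wHat (α : R.NonIso) : R.WHat := PresentedGroup.of α

theorem w_mul_self (hC : IsCompl C R.radical) (α : R.NonIso) : w hC α * w hC α = 1 := by
  ext1 u
  rw [LinearEquiv.mul_apply, w, refl]
  exact Module.involutive_reflection _ u

theorem w_conj (hC : IsCompl C R.radical) (α β γ : R.NonIso)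
    (h : γ.1 = β.1 - (2 * R.form β.1 α.1 / R.form α.1 α.1) • α.1) :
    w hC α * w hC β * w hC α = w hC γ := by
  have hαα : extForm hC (α.1, 0) (α.1, 0) = R.form α.1 α.1 := by simp [extForm_apply]
  have hβα : extForm hC (β.1, 0) (α.1, 0) = R.form β.1 α.1 := by simp [extForm_apply]
  have hγ : ((γ.1, 0) : R.HypExt) = w hC α (β.1, 0) := by
    rw [w, refl_apply, hαα, hβα, h]
    ext <;> simp
  have hiso : ∀ u v, extForm hC (w hC α u) (w hC α v) = extForm hC u v :=
    refl_mem_orthogonalGroup _ (extForm_symm hC) _ _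
  have hinv : ∀ u, w hC α (w hC α u) = u := fun u => by
    rw [← LinearEquiv.mul_apply, w_mul_self, LinearEquiv.coe_one, id]
  ext1 u
  rw [LinearEquiv.mul_apply, LinearEquiv.mul_apply]
  have e1 : w hC γ u = u - (2 * extForm hC u (γ.1, 0) /
      extForm hC (γ.1, 0) (γ.1, 0)) • ((γ.1, 0) : R.HypExt) := refl_apply _ _ _ _
  have e2 : w hC β (w hC α u) = w hC α u - (2 * extForm hC (w hC α u) (β.1, 0) /
      extForm hC (β.1, 0) (β.1, 0)) • ((β.1, 0) : R.HypExt) := refl_apply _ _ _ _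
  have e3 : extForm hC u (w hC α (β.1, 0)) = extForm hC (w hC α u) (β.1, 0) := by
    rw [← hiso, hinv]
  rw [e1, e2, hγ, map_sub, map_smul, hinv, hiso, e3]

/-- The epimorphism `ψ : Ŵ → W` with `ŵ_α ↦ w_α`. -/
def psi (hC : IsCompl C R.radical) : R.WHat →* weylGroup hC :=
  PresentedGroup.toGroup
    (f := fun α => (⟨w hC α, Subgroup.subset_closure ⟨α, rfl⟩⟩ : weylGroup hC)) (by
      rintro x (⟨α, rfl⟩ | ⟨α, β, γ, h, rfl⟩)
      · rw [map_pow, FreeGroup.lift_apply_of, pow_two]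
        exact Subtype.ext (w_mul_self hC α)
      · simp only [map_mul, map_inv, FreeGroup.lift_apply_of]
        rw [mul_inv_eq_one]
        exact Subtype.ext (w_conj hC α β γ h))

theorem psi_wHat (hC : IsCompl C R.radical) (α : R.NonIso) :
    (psi hC (wHat α) : R.HypExt ≃ₗ[ℝ] R.HypExt) = w hC α := by
  rw [psi, wHat, PresentedGroup.toGroup.of]

end EARS

/-! ### Type `A₁` -/

/-- The choices made for an extended affine root system `R` of type `A₁` and nullity `ν`:
a complement `C` of the radical `V⁰`, a vector `α₁ ∈ C` and a semilattice `S` in `V⁰` with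
`R = (S + S) ∪ (±α₁ + S)`, and a basis `σ` of `V⁰` consisting of elements of `S` whose `ℤ`-span is
that of `S`. -/
structure A1Data {V : Type*} [AddCommGroup V] [Module ℝ V] [TopologicalSpace V]
    (R : EARS V) (ν : ℕ) where
  C : Submodule ℝ V
  isCompl : IsCompl C R.radical
  α₁ : V
  α₁_mem : α₁ ∈ C
  S : Set R.radical
  isSemilattice : IsSemilattice S
  roots_eq : R.roots =
    {v | ∃ s ∈ S, ∃ t ∈ S, v = (s : V) + (t : V)} ∪
      {v | ∃ s ∈ S, v = α₁ + (s : V) ∨ v = -α₁ + (s : V)}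
  σ : Basis (Fin ν) ℝ R.radical
  σ_mem : ∀ i, σ i ∈ S
  span_int_eq : Submodule.span ℤ S = Submodule.span ℤ (Set.range σ)

namespace A1Data

variable {V : Type*} [AddCommGroup V] [Module ℝ V] [TopologicalSpace V]
  {R : EARS V} {ν : ℕ} (D : A1Data R ν)

theorem form_α₁_ne_zero : R.form D.α₁ D.α₁ ≠ 0 := by
  obtain ⟨α, hα, -⟩ := R.nonisolated 0 R.zero_mem (by simp)
  have hα1 := hα.1
  have hα2 := hα.2
  rw [D.roots_eq] at hα1
  rcases hα1 with ⟨s, -, t, -, rfl⟩ | ⟨s, -, rfl | rfl⟩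
  · rw [R.form_add_radical] at hα2
    exact absurd (by rw [show R.form (s : V) = 0 from s.2]; rfl) hα2
  · rwa [R.form_add_radical] at hα2
  · rw [R.form_add_radical] at hα2
    simpa using hα2

theorem add_tau_mem {J : Finset (Fin ν)} (hJ : J ∈ supp D.S D.σ) :
    D.α₁ + ((tau D.σ J : R.radical) : V) ∈ nonIsotropic R.form R.roots := by
  refine ⟨?_, ?_⟩
  · rw [D.roots_eq]
    exact Or.inr ⟨_, hJ, Or.inl rfl⟩
  · rw [R.form_add_radical]
    exact D.form_α₁_ne_zero

theorem empty_mem_supp : ∅ ∈ supp D.S D.σ := by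
  simpa [supp, tau] using D.isSemilattice.zero_mem

theorem singleton_mem_supp (r : Fin ν) : {r} ∈ supp D.S D.σ := by
  simpa [supp, tau] using D.σ_mem r

/-- The non-isotropic root `α₁ + τ_J`, for `J` in the support. -/
def root (J : Finset (Fin ν)) (hJ : J ∈ supp D.S D.σ) : R.NonIso :=
  ⟨D.α₁ + ((tau D.σ J : R.radical) : V), D.add_tau_mem hJ⟩

/-- `t̂_{1,r} = ŵ_{α₁ + σ_r} ŵ_{α₁}`. -/
def tHat (r : Fin ν) : R.WHat :=
  EARS.wHat (D.root {r} (D.singleton_mem_supp r)) * EARS.wHat (D.root ∅ D.empty_mem_supp)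

open Classical in
/-- `ẑ_J` is `ŵ_{α₁} ŵ_{α₁ + τ_J} ∏_{r ∈ J} t̂_{1,r}` (with `r` increasing) if `J` is in the
support, the commutator `x⁻¹ y⁻¹ x y` of `x = t̂_{1,r}` and `y = t̂_{1,s}` if `J = {r,s}`, `r < s`,
is not in the support, and `1` otherwise. -/
def zHat (J : Finset (Fin ν)) : R.WHat :=
  if hJ : J ∈ supp D.S D.σ then
    EARS.wHat (D.root ∅ D.empty_mem_supp) * EARS.wHat (D.root J hJ) *
      ((J.sort (· ≤ ·)).map D.tHat).prod
  else
    match J.sort (· ≤ ·) with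
    | [r, s] => (D.tHat r)⁻¹ * (D.tHat s)⁻¹ * D.tHat r * D.tHat s
    | _ => 1

/-- `Ẑ`, the subgroup of `Ŵ` generated by all `ẑ_J`. -/
def ZHat : Subgroup R.WHat := Subgroup.closure (Set.range D.zHat)

open Classical in
/-- `û(m,ε) = ∏_{r<s} ẑ_{r,s}^{m_{r,s}} ∏_J ẑ_J^{ε_J}`, with `J` in the essential support. The
factors are central, so the order in which the index sets are listed does not matter. -/
def uHat (m : Pairs ν → ℤ) (ε : Collection D.S D.σ) : R.WHat :=
  ((Finset.univ : Finset (Pairs ν)).toList.map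
    fun p => D.zHat {p.1.1, p.1.2} ^ m p).prod *
  ((Finset.univ : Finset (Esupp D.S D.σ)).toList.map
    fun J => D.zHat J.1 ^ (ε J : ℕ)).prod

end A1Data

end EAWG

end

noncomputable section

open Module

namespace EAWG

/-! Up to sign every non-isotropic root is `α₁ + s` with `s ∈ S`, so `Ŵ` is generated by involutions
`x_s` with `x_s x_t x_s = x_{2s-t}`. Hence `x_s x_t` conjugates `x_u` to `x_{u+2(s-t)}`, and any
product of such pairs with total translation `0` is central. This covers the commutators `c_{rs}` of
the `t̂_r` and all `ẑ_J`.

Squaring `x_{τ_J} = ẑ_J x_0 T_J⁻¹`, where `T_J` is the ordered product of the `t̂_r`, shows that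
`ẑ_J²` is the product of the `c_{rs}` over pairs in `J`. So every element of `Ẑ` has the form
`û(m,ε)`, and its square is `∏ c_{rs}^{e_{rs}}` with `e_{rs} = δ(r,s) m_{rs} + ∑_J δ(J,r,s) ε_J`
(`exists_eq_u`, `u_sq`). Condition (*) says precisely that all `e_{rs}` vanish.

The `c_{rs}` act on the hyperbolic extension independently (`eq_zero_of_prod_c_mem_ker`), so an
element of `Ẑ ∩ ker ψ` satisfies (*), and (*) makes its square trivial. Conversely `Ẑ` acts through
a torsion-free group, so its torsion lies in `ker ψ`.

Modulo `Ẑ` every element is `x_0^a ∏ t̂_r^{n_r}` with `a ∈ {0,1}`, and only the identity among these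
fixes `α₁`; thus `ker ψ ⊆ Ẑ`. Finally `ε_K` is recovered from `û(m,ε)` by the character of `Ŵ` that
is `-1` on `x_s` exactly when `s ∈ τ_K + 2Λ`. -/

theorem prod_zpow_eq_zpow_sum {ι G : Type*} [CommGroup G] (s : Finset ι) (f : ι → ℤ) (a : G) :
    ∏ i ∈ s, a ^ f i = a ^ ∑ i ∈ s, f i := by
  classical
  induction s using Finset.induction_on with
  | empty => simp
  | insert i s hi ih => rw [Finset.prod_insert hi, Finset.sum_insert hi, zpow_add, ih]

/-! ### Consequences of the defining relations -/

namespace EARS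

variable {V : Type*} [AddCommGroup V] [Module ℝ V] [TopologicalSpace V] {R : EARS V}

theorem wHat_mul_self (α : R.NonIso) : wHat α * wHat α = 1 := by
  have := PresentedGroup.one_of_mem (rels := R.relations) (x := FreeGroup.of α ^ 2)
    (Or.inl ⟨α, rfl⟩)
  rwa [map_pow, pow_two] at this

theorem wHat_conj (α β γ : R.NonIso)
    (h : γ.1 = β.1 - (2 * R.form β.1 α.1 / R.form α.1 α.1) • α.1) :
    wHat α * wHat β * wHat α = wHat γ := by
  have := PresentedGroup.one_of_mem (rels := R.relations) (Or.inr ⟨α, β, γ, h, rfl⟩)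
  rwa [map_mul, map_mul, map_mul, map_inv, mul_inv_eq_one] at this

/-- Reflecting `α` in itself gives `-α`, so `ŵ_{-α} = ŵ_α³ = ŵ_α`. -/
theorem wHat_neg (α β : R.NonIso) (h : β.1 = -α.1) : wHat β = wHat α := by
  have h1 := wHat_conj α α β (by
    rw [h, mul_div_assoc, div_self α.2.2]
    module)
  rw [← h1, wHat_mul_self, one_mul]

theorem form_radical_left (s : R.radical) (v : V) : R.form s v = 0 := by
  rw [show R.form (s : V) = 0 from s.2]; rfl

theorem form_radical_right (v : V) (s : R.radical) : R.form v s = 0 := by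
  rw [R.form_symm, form_radical_left]

end EARS

namespace A1Data

open EARS

variable {V : Type*} [AddCommGroup V] [Module ℝ V] [TopologicalSpace V]
  {R : EARS V} {ν : ℕ} (D : A1Data R ν)

/-! ### Generators indexed by the semilattice -/

theorem form_add_add (s t : R.radical) :
    R.form (D.α₁ + s) (D.α₁ + t) = R.form D.α₁ D.α₁ := by
  simp [form_radical_right]

/-- The non-isotropic root `α₁ + s`, for `s ∈ S`. -/
def shiftRoot (s : D.S) : R.NonIso :=
  ⟨D.α₁ + ((s : R.radical) : V), by
    rw [D.roots_eq]; exact Or.inr ⟨s, s.2, Or.inl rfl⟩, by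
    rw [form_add_add]; exact D.form_α₁_ne_zero⟩

/-- The generator `ŵ_{α₁ + s}` of `Ŵ`, for `s ∈ S`. -/
def xHat (s : D.S) : R.WHat := wHat (D.shiftRoot s)

theorem wHat_eq_xHat (α : R.NonIso) : ∃ s, wHat α = D.xHat s := by
  obtain ⟨α, hα1, hα2⟩ := α
  have hα3 := hα1
  rw [D.roots_eq] at hα3
  rcases hα3 with ⟨s, -, t, -, h⟩ | ⟨s, hs, h | h⟩
  · rw [h, map_add, form_radical_right, form_radical_right] at hα2
    simp at hα2
  · exact ⟨⟨s, hs⟩, congrArg wHat (Subtype.ext h)⟩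
  · have hs' : -s ∈ D.S := by
      -- `-s = s - 2s`, so `S` is symmetric.
      have := D.isSemilattice.sub_two_smul_mem s hs s hs
      rwa [two_smul, sub_add_cancel_left] at this
    refine ⟨⟨-s, hs'⟩, (wHat_neg _ _ ?_).symm⟩
    simp [shiftRoot, h, add_comm]

theorem closure_range_xHat : Subgroup.closure (Set.range D.xHat) = ⊤ := by
  rw [eq_top_iff, ← PresentedGroup.closure_range_of, Subgroup.closure_le]
  rintro _ ⟨α, rfl⟩
  obtain ⟨s, hs⟩ := D.wHat_eq_xHat α
  exact Subgroup.subset_closure ⟨s, hs.symm⟩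

theorem xHat_mul_self (s : D.S) : D.xHat s * D.xHat s = 1 := wHat_mul_self _

theorem xHat_inv (s : D.S) : (D.xHat s)⁻¹ = D.xHat s :=
  inv_eq_of_mul_eq_one_left (D.xHat_mul_self s)

/-- The reflection in `α₁ + s` sends `α₁ + t` to `-(α₁ + 2s - t)`, and the sign is absorbed by
`wHat_neg`. -/
theorem xHat_conj (s t u : D.S) (h : (u : R.radical) = (2 : ℤ) • (s : R.radical) - t) :
    D.xHat s * D.xHat t * D.xHat s = D.xHat u := by
  have h2 : 2 * R.form (D.α₁ + (t : R.radical)) (D.α₁ + (s : R.radical)) /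
      R.form (D.α₁ + (s : R.radical)) (D.α₁ + (s : R.radical)) = 2 := by
    rw [form_add_add, form_add_add]
    field_simp [D.form_α₁_ne_zero]
  have hmem : -D.α₁ + ((-(u : R.radical) : R.radical) : V) ∈ nonIsotropic R.form R.roots := by
    have hu := R.neg_mem _ (D.shiftRoot u).2.1
    have hu' := (D.shiftRoot u).2.2
    have e : -D.α₁ + ((-(u : R.radical) : R.radical) : V) = -(D.shiftRoot u).1 := by
      simp [shiftRoot, add_comm]
    rw [e]
    exact ⟨hu, by simpa using hu'⟩
  rw [xHat, xHat, xHat, wHat_conj (D.shiftRoot s) (D.shiftRoot t) ⟨_, hmem⟩]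
  · symm
    apply wHat_neg
    simp [shiftRoot, add_comm]
  · change _ = (D.α₁ + ((t : R.radical) : V)) - (_ / _) • (D.α₁ + ((s : R.radical) : V))
    erw [h2]
    change -D.α₁ + ((-(u : R.radical) : R.radical) : V) = _
    rw [h]
    push_cast
    module

theorem two_smul_sub_mem (s t : D.S) : (2 : ℤ) • (s : R.radical) - t ∈ D.S := by
  have h1 := D.isSemilattice.sub_two_smul_mem t t.2 t t.2
  have h2 := D.isSemilattice.add_two_smul_mem _ h1 s s.2
  convert h2 using 1
  module

/-! ### Conjugation as translation, and central elements -/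

/-- Conjugation by `g` maps `ŵ_{α₁ + u}` to `ŵ_{α₁ + u + 2l}`. -/
def ConjTranslates (g : R.WHat) (l : R.radical) : Prop :=
  l ∈ Submodule.span ℤ D.S ∧
    ∀ u v : D.S, (v : R.radical) = u + (2 : ℤ) • l → g * D.xHat u * g⁻¹ = D.xHat v

variable {D}

theorem ConjTranslates.one : D.ConjTranslates 1 0 :=
  ⟨zero_mem _, fun u v h => by
    rw [smul_zero, add_zero] at h
    rw [Subtype.ext h]; group⟩

theorem ConjTranslates.mul {g h : R.WHat} {l m : R.radical} (hg : D.ConjTranslates g l)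
    (hh : D.ConjTranslates h m) : D.ConjTranslates (g * h) (l + m) := by
  refine ⟨add_mem hg.1 hh.1, fun u v e => ?_⟩
  have hu := D.isSemilattice.add_two_smul_span_mem hh.1 u u.2
  rw [← hg.2 ⟨_, hu⟩ v (by rw [e]; module), ← hh.2 u ⟨_, hu⟩ rfl]
  group

theorem ConjTranslates.inv {g : R.WHat} {l : R.radical} (hg : D.ConjTranslates g l) :
    D.ConjTranslates g⁻¹ (-l) := by
  refine ⟨neg_mem hg.1, fun u v e => ?_⟩
  rw [← hg.2 v u (by rw [e]; module)]
  group

/-- Conjugation by `x_s` acts on indices as the point reflection `u ↦ 2s - u`; two point reflections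
compose to a translation. -/
theorem ConjTranslates.xHat_mul_xHat (s t : D.S) :
    D.ConjTranslates (D.xHat s * D.xHat t) ((s : R.radical) - t) := by
  refine ⟨sub_mem (Submodule.subset_span s.2) (Submodule.subset_span t.2), fun u v e => ?_⟩
  rw [← D.xHat_conj s ⟨_, D.two_smul_sub_mem t u⟩ v (by rw [e]; module),
    ← D.xHat_conj t u ⟨_, D.two_smul_sub_mem t u⟩ rfl, mul_inv_rev, xHat_inv, xHat_inv]
  group

theorem mem_center_of_commute {g : R.WHat} (h : ∀ u, g * D.xHat u = D.xHat u * g) :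
    g ∈ Subgroup.center R.WHat := by
  have : (⊤ : Subgroup R.WHat) ≤ Subgroup.centralizer {g} := by
    rw [← D.closure_range_xHat, Subgroup.closure_le]
    rintro _ ⟨u, rfl⟩
    exact Subgroup.mem_centralizer_singleton_iff.2 (h u).symm
  rw [Subgroup.mem_center_iff]
  exact fun x => Subgroup.mem_centralizer_singleton_iff.1 (this (Subgroup.mem_top x))

theorem ConjTranslates.mem_center {g : R.WHat} (hg : D.ConjTranslates g 0) :
    g ∈ Subgroup.center R.WHat := by
  refine mem_center_of_commute (D := D) fun u => ?_
  have := hg.2 u u (by simp)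
  rwa [mul_inv_eq_iff_eq_mul] at this

variable (D)

/-! ### The central elements `ẑ_J` -/

/-- `τ_J` as an element of `S`. -/
def tauS (J : Finset (Fin ν)) (hJ : J ∈ supp D.S D.σ) : D.S := ⟨tau D.σ J, hJ⟩

@[simp] theorem coe_tauS (J : Finset (Fin ν)) (hJ : J ∈ supp D.S D.σ) :
    (D.tauS J hJ : R.radical) = tau D.σ J := rfl

/-- `0` as an element of `S`, written as an empty sum. -/
abbrev zeroS : D.S := D.tauS ∅ D.empty_mem_supp

theorem tau_empty : tau D.σ ∅ = 0 := by simp [tau]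

theorem tau_singleton (r : Fin ν) : tau D.σ {r} = D.σ r := by simp [tau]

theorem tHat_eq (r : Fin ν) :
    D.tHat r = D.xHat (D.tauS {r} (D.singleton_mem_supp r)) * D.xHat D.zeroS := rfl

theorem ConjTranslates.tHat (r : Fin ν) : D.ConjTranslates (D.tHat r) (D.σ r) := by
  have := ConjTranslates.xHat_mul_xHat (D := D) (D.tauS {r} (D.singleton_mem_supp r)) D.zeroS
  simpa [tau_empty, tau_singleton, tHat_eq] using this

theorem xHat_zeroS_conj_tHat (r : Fin ν) :
    D.xHat D.zeroS * D.tHat r * D.xHat D.zeroS = (D.tHat r)⁻¹ := by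
  rw [tHat_eq, mul_inv_rev, xHat_inv, xHat_inv, mul_assoc, mul_assoc, xHat_mul_self, mul_one]

theorem ConjTranslates.list_prod (L : List (Fin ν)) :
    D.ConjTranslates (L.map D.tHat).prod (L.map D.σ).sum := by
  induction L with
  | nil => exact ConjTranslates.one
  | cons a L ih =>
    rw [List.map_cons, List.prod_cons, List.map_cons, List.sum_cons]
    exact (ConjTranslates.tHat D a).mul ih

theorem sum_map_sort (J : Finset (Fin ν)) :
    ((J.sort (· ≤ ·)).map D.σ).sum = tau D.σ J := by
  rw [tau, ← List.sum_toFinset _ (J.sort_nodup _), Finset.sort_toFinset]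

/-- The commutator `t̂_r t̂_s t̂_r⁻¹ t̂_s⁻¹`. -/
def comm (r s : Fin ν) : R.WHat := D.tHat r * D.tHat s * (D.tHat r)⁻¹ * (D.tHat s)⁻¹

theorem comm_mem_center (r s : Fin ν) : D.comm r s ∈ Subgroup.center R.WHat := by
  have hr := ConjTranslates.tHat D r
  have hs := ConjTranslates.tHat D s
  have := ((hr.mul hs).mul hr.inv).mul hs.inv
  rw [show D.σ r + D.σ s + -D.σ r + -D.σ s = 0 by abel] at this
  exact this.mem_center

/-- The left side is the conjugate of the commutator by `(t̂_s t̂_r)⁻¹`, and the commutator is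
central. This reconciles the convention in `zHat` with `comm`. -/
theorem comm_eq_inv_inv (r s : Fin ν) :
    (D.tHat r)⁻¹ * (D.tHat s)⁻¹ * D.tHat r * D.tHat s = D.comm r s := by
  have h := Subgroup.mem_center_iff.1 (D.comm_mem_center r s) (D.tHat s * D.tHat r)
  have h2 : D.tHat r * D.tHat s = D.tHat s * D.tHat r * D.comm r s := by
    rw [h, comm]; group
  have h3 := Subgroup.mem_center_iff.1 (D.comm_mem_center r s)
  calc _ = (D.tHat r)⁻¹ * (D.tHat s)⁻¹ * (D.tHat r * D.tHat s) := by group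
    _ = _ := by rw [h2]; group

theorem zHat_of_mem {J : Finset (Fin ν)} (hJ : J ∈ supp D.S D.σ) :
    D.zHat J = D.xHat D.zeroS * D.xHat (D.tauS J hJ) *
      ((J.sort (· ≤ ·)).map D.tHat).prod := by
  rw [zHat, dif_pos hJ]; rfl

theorem sort_pair {r s : Fin ν} (h : r < s) :
    ({r, s} : Finset (Fin ν)).sort (· ≤ ·) = [r, s] := by
  rw [Finset.sort_insert _ (by simp [h.le]) (by simp [h.ne]), Finset.sort_singleton]

theorem zHat_pair_of_notMem {r s : Fin ν} (h : r < s) (hJ : {r, s} ∉ supp D.S D.σ) :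
    D.zHat {r, s} = D.comm r s := by
  rw [zHat, dif_neg hJ, sort_pair h]
  exact D.comm_eq_inv_inv r s

theorem zHat_of_notMem_of_card {J : Finset (Fin ν)} (hJ : J ∉ supp D.S D.σ) (h : J.card ≠ 2) :
    D.zHat J = 1 := by
  rw [zHat, dif_neg hJ]
  split
  · next r s e =>
    have := congrArg List.length e
    rw [Finset.length_sort] at this
    exact absurd this h
  · rfl

theorem zHat_empty : D.zHat ∅ = 1 := by
  rw [zHat_of_mem D D.empty_mem_supp, Finset.sort_empty]
  simpa using D.xHat_mul_self D.zeroS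

theorem zHat_singleton (r : Fin ν) : D.zHat {r} = 1 := by
  rw [zHat_of_mem D (D.singleton_mem_supp r), Finset.sort_singleton]
  simp only [List.map_cons, List.map_nil, List.prod_cons, List.prod_nil, mul_one]
  rw [tHat_eq, mul_assoc, ← mul_assoc (D.xHat _) (D.xHat _) (D.xHat D.zeroS), xHat_mul_self,
    one_mul, xHat_mul_self]

theorem pair_of_card_eq_two {J : Finset (Fin ν)} (h : J.card = 2) :
    ∃ r s, r < s ∧ J = {r, s} := by
  obtain ⟨a, b, hab, rfl⟩ := Finset.card_eq_two.1 h
  rcases lt_or_gt_of_ne hab with h | h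
  · exact ⟨a, b, h, rfl⟩
  · exact ⟨b, a, h, Finset.pair_comm _ _⟩

theorem zHat_mem_center (J : Finset (Fin ν)) : D.zHat J ∈ Subgroup.center R.WHat := by
  by_cases hJ : J ∈ supp D.S D.σ
  · rw [zHat_of_mem D hJ]
    apply ConjTranslates.mem_center (D := D)
    -- The total translation is `(0 - τ_J) + ∑_{r ∈ J} σ_r = 0`.
    convert (ConjTranslates.xHat_mul_xHat D.zeroS (D.tauS J hJ)).mul
      (ConjTranslates.list_prod D (J.sort (· ≤ ·))) using 1
    rw [sum_map_sort]
    simp [tau_empty]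
  · by_cases h2 : J.card = 2
    · obtain ⟨r, s, hrs, rfl⟩ := pair_of_card_eq_two h2
      rw [zHat_pair_of_notMem D hrs hJ]
      exact D.comm_mem_center r s
    · rw [zHat_of_notMem_of_card D hJ h2]
      exact one_mem _

theorem ZHat_le_center : D.ZHat ≤ Subgroup.center R.WHat := by
  rw [ZHat, Subgroup.closure_le]
  rintro _ ⟨J, rfl⟩
  exact D.zHat_mem_center J

instance : CommGroup D.ZHat :=
  { (inferInstance : Group D.ZHat) with
    mul_comm := fun a b => Subtype.ext (Subgroup.mem_center_iff.1 (D.ZHat_le_center b.2) a) }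

instance : D.ZHat.Normal :=
  ⟨fun n hn g => by
    rw [Subgroup.mem_center_iff.1 (D.ZHat_le_center hn) g, mul_inv_cancel_right]
    exact hn⟩

/-- `ẑ_J` as an element of the commutative group `Ẑ`. -/
def z (J : Finset (Fin ν)) : D.ZHat := ⟨D.zHat J, Subgroup.subset_closure ⟨J, rfl⟩⟩

@[simp] theorem coe_z (J : Finset (Fin ν)) : (D.z J : R.WHat) = D.zHat J := rfl

/-! ### Squares of the `ẑ_J` as products of commutators -/

/-- The product of the commutators over all pairs of members of a list, in order. -/
def pairProd : List (Fin ν) → R.WHat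
  | [] => 1
  | r :: L => (L.map (D.comm r)).prod * pairProd L

/-- The inverses are not in reversed order, so nothing telescopes: moving each `t̂_r⁻¹` left past
the later factors leaves their central commutators with `t̂_r`. -/
theorem list_prod_mul_list_inv_prod (L : List (Fin ν)) :
    (L.map D.tHat).prod * (L.map fun r => (D.tHat r)⁻¹).prod = D.pairProd L := by
  induction L with
  | nil => simp [pairProd]
  | cons r L ih =>
    have key : ∀ M : List (Fin ν), (M.map (D.comm r)).prod ∈ Subgroup.center R.WHat ∧
        D.tHat r * (M.map D.tHat).prod * (D.tHat r)⁻¹ =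
        (M.map (D.comm r)).prod * (M.map D.tHat).prod := by
      intro M
      induction M with
      | nil => exact ⟨one_mem _, by simp⟩
      | cons s M ihM =>
        simp only [List.map_cons, List.prod_cons]
        refine ⟨mul_mem (D.comm_mem_center r s) ihM.1, ?_⟩
        have h1 : D.tHat r * D.tHat s * (D.tHat r)⁻¹ = D.comm r s * D.tHat s := by
          rw [comm]; group
        calc _ = (D.tHat r * D.tHat s * (D.tHat r)⁻¹) *
              (D.tHat r * (M.map D.tHat).prod * (D.tHat r)⁻¹) := by group
          _ = D.comm r s * (D.tHat s * (M.map (D.comm r)).prod) * (M.map D.tHat).prod := by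
              rw [h1, ihM.2]; group
          _ = _ := by rw [Subgroup.mem_center_iff.1 ihM.1]; group
    simp only [List.map_cons, List.prod_cons]
    rw [pairProd, ← ih, ← mul_assoc, (key L).2, mul_assoc]

theorem xHat_zeroS_conj_list_prod (L : List (Fin ν)) :
    D.xHat D.zeroS * (L.map D.tHat).prod * D.xHat D.zeroS =
      (L.map fun r => (D.tHat r)⁻¹).prod := by
  induction L with
  | nil => simp [xHat_mul_self]
  | cons r L ih =>
    simp only [List.map_cons, List.prod_cons]
    rw [← ih, ← xHat_zeroS_conj_tHat]
    calc _ = D.xHat D.zeroS * D.tHat r * 1 * (L.map D.tHat).prod * D.xHat D.zeroS := by group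
      _ = _ := by rw [← D.xHat_mul_self D.zeroS]; group

theorem xHat_eq_of_mem {J : Finset (Fin ν)} (hJ : J ∈ supp D.S D.σ) :
    D.xHat (D.tauS J hJ) =
      D.zHat J * D.xHat D.zeroS * (((J.sort (· ≤ ·)).map D.tHat).prod)⁻¹ := by
  rw [← Subgroup.mem_center_iff.1 (D.zHat_mem_center J), zHat_of_mem D hJ, ← mul_assoc,
    ← mul_assoc, xHat_mul_self]
  group

/-- Squaring `x_{τ_J} = ẑ_J x_0 T⁻¹` gives `1 = ẑ_J² (x_0 T⁻¹ x_0 T⁻¹)`, so `ẑ_J² = T · x_0 T x_0`;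
conjugation by `x_0` inverts each factor of `T` but keeps the order. -/
theorem zHat_sq_of_mem {J : Finset (Fin ν)} (hJ : J ∈ supp D.S D.σ) :
    D.zHat J ^ 2 = D.pairProd (J.sort (· ≤ ·)) := by
  rw [← list_prod_mul_list_inv_prod, ← xHat_zeroS_conj_list_prod]
  set T := ((J.sort (· ≤ ·)).map D.tHat).prod
  have h1 := D.xHat_mul_self (D.tauS J hJ)
  have hz := Subgroup.mem_center_iff.1 (D.zHat_mem_center J)
  rw [xHat_eq_of_mem] at h1
  set y := D.zHat J
  set x := D.xHat D.zeroS
  have hx : x * x = 1 := D.xHat_mul_self _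
  have h2 : y ^ 2 * (x * T⁻¹ * x * T⁻¹) = 1 := by
    calc _ = y * (y * (x * T⁻¹)) * (x * T⁻¹) := by rw [pow_two]; group
      _ = _ := by rw [← hz (x * T⁻¹), ← h1]; simp only [mul_assoc]; rfl
  have h3 : (x * T⁻¹ * x * T⁻¹)⁻¹ = T * (x * T * x) := by
    have : x⁻¹ = x := D.xHat_inv _
    simp only [mul_inv_rev, inv_inv, this]
    group
  rw [← h3]
  exact eq_inv_of_mul_eq_one_left h2

theorem comm_eq_zHat_sq {r s : Fin ν} (h : r < s) (hJ : {r, s} ∈ supp D.S D.σ) :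
    D.comm r s = D.zHat {r, s} ^ 2 := by
  rw [zHat_sq_of_mem D hJ, sort_pair h]
  simp [pairProd]

theorem comm_mem_ZHat {r s : Fin ν} (h : r < s) : D.comm r s ∈ D.ZHat := by
  by_cases hJ : {r, s} ∈ supp D.S D.σ
  · rw [comm_eq_zHat_sq D h hJ]
    exact pow_mem (D.z _).2 2
  · rw [← zHat_pair_of_notMem D h hJ]
    exact (D.z _).2

open Classical in
/-- The commutator `t̂_r t̂_s t̂_r⁻¹ t̂_s⁻¹`, for `r < s`, as an element of `Ẑ`; otherwise `1`. -/
def c (r s : Fin ν) : D.ZHat := if h : r < s then ⟨D.comm r s, D.comm_mem_ZHat h⟩ else 1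

theorem coe_c {r s : Fin ν} (h : r < s) : (D.c r s : R.WHat) = D.comm r s := by
  rw [c, dif_pos h]

theorem c_of_not_lt {r s : Fin ν} (h : ¬ r < s) : D.c r s = 1 := by rw [c, dif_neg h]

theorem pairProd_sort (J : Finset (Fin ν)) :
    D.pairProd (J.sort (· ≤ ·)) = ((∏ r ∈ J, ∏ s ∈ J, D.c r s : D.ZHat) : R.WHat) := by
  induction J using Finset.induction_on_min with
  | empty => simp [pairProd]
  | insert a J ha ih =>
    have haJ : a ∉ J := fun h => lt_irrefl a (ha a h)
    rw [Finset.sort_insert _ (fun b hb => (ha b hb).le) haJ, pairProd, ih, Finset.prod_insert haJ,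
      Finset.prod_insert haJ, c_of_not_lt D (lt_irrefl a), one_mul, Subgroup.coe_mul]
    congr 1
    · have h := List.prod_toFinset (D.c a) (J.sort_nodup (· ≤ ·))
      rw [Finset.sort_toFinset] at h
      rw [h, ← Subgroup.coe_subtype, map_list_prod, List.map_map]
      congr 1
      refine List.map_congr_left fun s hs => ?_
      exact (coe_c D (ha s ((Finset.mem_sort _).1 hs))).symm
    · congr 1
      refine Finset.prod_congr rfl fun r hr => ?_
      rw [Finset.prod_insert haJ, c_of_not_lt D (ha r hr).not_gt, one_mul]

theorem prod_prod_c (J : Finset (Fin ν)) :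
    ∏ r ∈ J, ∏ s ∈ J, D.c r s =
      ∏ p : Pairs ν, if ({p.1.1, p.1.2} : Finset (Fin ν)) ⊆ J then D.c p.1.1 p.1.2 else 1 := by
  rw [← Finset.prod_product', ← Finset.prod_subtype (Finset.univ.filter fun q : Fin ν × Fin ν =>
      q.1 < q.2) (by simp) (fun q : Fin ν × Fin ν =>
      if ({q.1, q.2} : Finset (Fin ν)) ⊆ J then D.c q.1 q.2 else 1), ← Finset.prod_filter]
  symm
  refine Finset.prod_subset (fun q hq => ?_) fun q hq hq' => ?_
  · simpa [Finset.insert_subset_iff] using (Finset.mem_filter.1 hq).2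
  · apply c_of_not_lt
    intro h
    exact hq' (by simpa [h, Finset.insert_subset_iff] using hq)

theorem z_sq_of_mem_Esupp (J : Esupp D.S D.σ) :
    D.z J.1 ^ 2 = ∏ p : Pairs ν, D.c p.1.1 p.1.2 ^ deltaJ J.1 p := by
  apply Subtype.ext
  rw [Subgroup.coe_pow, coe_z, zHat_sq_of_mem D J.2.1, pairProd_sort, prod_prod_c]
  congr 1
  refine Finset.prod_congr rfl fun p _ => ?_
  -- Since `J` has at least three elements, a pair inside it is automatically a proper subset.
  have h : ({p.1.1, p.1.2} : Finset (Fin ν)) ⊂ J.1 ↔ ({p.1.1, p.1.2} : Finset (Fin ν)) ⊆ J.1 := by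
    refine ⟨fun h => h.1, fun h => h.ssubset_of_ne fun e => ?_⟩
    have h3 := J.2.2
    rw [← e] at h3
    have := Finset.card_le_two (a := p.1.1) (b := p.1.2)
    omega
  by_cases h' : ({p.1.1, p.1.2} : Finset (Fin ν)) ⊆ J.1
  · rw [if_pos h', deltaJ, if_pos (h.2 h'), pow_one]
  · rw [if_neg h', deltaJ, if_neg (mt h.1 h'), pow_zero]

/-- Treats both kinds of pairs at once: `c = ẑ²` on the support (`δ = 1`), and `c = ẑ` off it (`δ =
2`). -/
theorem c_pow_delta (p : Pairs ν) :
    D.c p.1.1 p.1.2 ^ delta D.S D.σ p = D.z {p.1.1, p.1.2} ^ 2 := by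
  apply Subtype.ext
  rw [Subgroup.coe_pow, Subgroup.coe_pow, coe_z, coe_c D p.2, delta]
  split_ifs with h
  · rw [comm_eq_zHat_sq D p.2 h, pow_one]
  · rw [zHat_pair_of_notMem D p.2 h]

theorem exists_c_eq_zpow (p : Pairs ν) : ∃ e : ℤ, D.c p.1.1 p.1.2 = D.z {p.1.1, p.1.2} ^ e := by
  by_cases h : ({p.1.1, p.1.2} : Finset (Fin ν)) ∈ supp D.S D.σ
  · exact ⟨2, Subtype.ext (by
      rw [coe_c D p.2, comm_eq_zHat_sq D p.2 h]; rfl)⟩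
  · exact ⟨1, Subtype.ext (by
      rw [coe_c D p.2, ← zHat_pair_of_notMem D p.2 h, zpow_one]; rfl)⟩

/-! ### Normal form in `Ẑ` -/

open Classical in
/-- `û(m,ε)` as an element of `Ẑ`. -/
def u (m : Pairs ν → ℤ) (ε : Collection D.S D.σ) : D.ZHat :=
  (∏ p : Pairs ν, D.z {p.1.1, p.1.2} ^ m p) * ∏ J : Esupp D.S D.σ, D.z J.1 ^ (ε J : ℕ)

theorem coe_u (m : Pairs ν → ℤ) (ε : Collection D.S D.σ) : (D.u m ε : R.WHat) = D.uHat m ε := by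
  rw [u, uHat, Subgroup.coe_mul]
  congr 1
  · rw [← Finset.prod_map_toList]
    rw [← Subgroup.coe_subtype, map_list_prod, List.map_map]
    rfl
  · rw [← Finset.prod_map_toList]
    rw [← Subgroup.coe_subtype, map_list_prod, List.map_map]
    rfl

open Classical in
/-- The exponents of the square of `û(m,ε)` with respect to the commutators. -/
def sqExp (m : Pairs ν → ℤ) (ε : Collection D.S D.σ) (p : Pairs ν) : ℤ :=
  delta D.S D.σ p * m p + ∑ J : Esupp D.S D.σ, (deltaJ J.1 p : ℤ) * ((ε J : ℕ) : ℤ)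

theorem u_sq (m : Pairs ν → ℤ) (ε : Collection D.S D.σ) :
    D.u m ε ^ 2 = ∏ p : Pairs ν, D.c p.1.1 p.1.2 ^ D.sqExp m ε p := by
  classical
  simp only [sqExp, zpow_add, Finset.prod_mul_distrib, u, mul_pow]
  congr 1
  · rw [← Finset.prod_pow]
    refine Finset.prod_congr rfl fun p _ => ?_
    rw [zpow_mul, zpow_natCast, c_pow_delta, ← zpow_natCast, ← zpow_natCast, zpow_comm]
  · rw [← Finset.prod_pow]
    calc _ = ∏ J : Esupp D.S D.σ, ∏ p : Pairs ν,
          D.c p.1.1 p.1.2 ^ ((deltaJ J.1 p : ℤ) * ((ε J : ℕ) : ℤ)) := by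
          refine Finset.prod_congr rfl fun J _ => ?_
          rw [← pow_mul, mul_comm, pow_mul, z_sq_of_mem_Esupp, ← Finset.prod_pow]
          refine Finset.prod_congr rfl fun p _ => ?_
          rw [zpow_mul, zpow_natCast, zpow_natCast]
      _ = _ := by
          rw [Finset.prod_comm]
          refine Finset.prod_congr rfl fun p _ => ?_
          rw [prod_zpow_eq_zpow_sum]

theorem sqExp_eq_zero_iff (m : Pairs ν → ℤ) (ε : Collection D.S D.σ) (p : Pairs ν) :
    D.sqExp m ε p = 0 ↔ (m p : ℚ) = - integralSum D.S D.σ ε p := by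
  have hd : (delta D.S D.σ p : ℚ) ≠ 0 := by
    rw [delta]; split_ifs <;> norm_num
  rw [← Int.cast_inj (α := ℚ), sqExp, integralSum]
  push_cast
  rw [one_div, ← mul_neg, eq_inv_mul_iff_mul_eq₀ hd, eq_neg_iff_add_eq_zero]

open Classical in
theorem exists_eq_prod_zpow (x : D.ZHat) : ∃ (m : Pairs ν → ℤ) (k : Esupp D.S D.σ → ℤ),
    x = (∏ p : Pairs ν, D.z {p.1.1, p.1.2} ^ m p) *
      ∏ J : Esupp D.S D.σ, D.z J.1 ^ k J := by
  obtain ⟨x, hx⟩ := x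
  induction hx using Subgroup.closure_induction with
  | mem x hx =>
    obtain ⟨J, rfl⟩ := hx
    by_cases h2 : J.card = 2
    · obtain ⟨r, s, hrs, rfl⟩ := pair_of_card_eq_two h2
      refine ⟨Pi.single ⟨(r, s), hrs⟩ 1, 0, ?_⟩
      rw [Finset.prod_eq_single ⟨(r, s), hrs⟩]
      · simp; rfl
      · intro p _ hp
        rw [Pi.single_eq_of_ne hp, zpow_zero]
      · simp
    by_cases hJ : J ∈ supp D.S D.σ
    · by_cases h3 : 3 ≤ J.card
      · refine ⟨0, Pi.single ⟨J, hJ, h3⟩ 1, ?_⟩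
        rw [Finset.prod_eq_single (⟨J, hJ, h3⟩ : Esupp D.S D.σ)]
        · simp; rfl
        · intro p _ hp
          rw [Pi.single_eq_of_ne hp, zpow_zero]
        · simp
      · refine ⟨0, 0, Subtype.ext ?_⟩
        have : J.card = 0 ∨ J.card = 1 := by omega
        rcases this with h | h
        · rw [Finset.card_eq_zero.1 h]
          simp [zHat_empty]
        · obtain ⟨r, rfl⟩ := Finset.card_eq_one.1 h
          simp [zHat_singleton]
    · exact ⟨0, 0, Subtype.ext (by simp [zHat_of_notMem_of_card D hJ h2])⟩
  | one => exact ⟨0, 0, Subtype.ext (by simp)⟩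
  | mul x y hx hy ihx ihy =>
    obtain ⟨m, k, h⟩ := ihx
    obtain ⟨m', k', h'⟩ := ihy
    refine ⟨m + m', k + k', ?_⟩
    calc _ = (⟨x, hx⟩ : D.ZHat) * ⟨y, hy⟩ := rfl
      _ = _ := by
        rw [h, h']
        simp only [Pi.add_apply, zpow_add, Finset.prod_mul_distrib]
        exact mul_mul_mul_comm _ _ _ _
  | inv x hx ihx =>
    obtain ⟨m, k, h⟩ := ihx
    refine ⟨-m, -k, ?_⟩
    calc _ = (⟨x, hx⟩ : D.ZHat)⁻¹ := rfl
      _ = _ := by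
        rw [h]
        simp only [Pi.neg_apply, zpow_neg, Finset.prod_inv_distrib, mul_inv]

theorem exists_eq_u (x : D.ZHat) : ∃ m ε, x = D.u m ε := by
  classical
  obtain ⟨m, k, rfl⟩ := D.exists_eq_prod_zpow x
  choose e he using D.exists_c_eq_zpow
  -- Split `k J` by division by two: the remainder is `ε_J`, and the even part turns into
  -- commutators, hence into powers `e p` of the `ẑ_{r,s}`.
  refine ⟨fun p => m p + ∑ J : Esupp D.S D.σ, e p * (deltaJ J.1 p * (k J / 2)),
    fun J => ⟨(k J % 2).toNat, by omega⟩, ?_⟩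
  have h1 : ∀ J : Esupp D.S D.σ, D.z J.1 ^ k J =
      (∏ p : Pairs ν, D.z {p.1.1, p.1.2} ^ (e p * (deltaJ J.1 p * (k J / 2)))) *
      D.z J.1 ^ (k J % 2).toNat := by
    intro J
    have h2 : ((k J % 2).toNat : ℤ) = k J % 2 := by omega
    rw [← zpow_natCast, h2]
    nth_rewrite 1 [← Int.mul_ediv_add_emod (k J) 2]
    rw [zpow_add, zpow_mul]
    congr 1
    rw [show D.z J.1 ^ (2 : ℤ) = D.z J.1 ^ 2 from rfl, z_sq_of_mem_Esupp, ← Finset.prod_zpow]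
    refine Finset.prod_congr rfl fun p _ => ?_
    rw [zpow_mul, ← he, zpow_mul, zpow_natCast]
  rw [Finset.prod_congr rfl fun J _ => h1 J, Finset.prod_mul_distrib, u, ← mul_assoc]
  congr 1
  simp only [zpow_add, Finset.prod_mul_distrib]
  rw [Finset.prod_comm]
  congr 1
  refine Finset.prod_congr rfl fun p _ => ?_
  rw [prod_zpow_eq_zpow_sum]

/-! ### Action on the hyperbolic extension -/

/-- The action of `Ŵ` on the hyperbolic extension. -/
def act : R.WHat →* (R.HypExt ≃ₗ[ℝ] R.HypExt) :=
  (weylGroup D.isCompl).subtype.comp (psi D.isCompl)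

theorem mem_ker_psi_iff (g : R.WHat) : g ∈ (psi D.isCompl).ker ↔ D.act g = 1 := by
  rw [MonoidHom.mem_ker, act, MonoidHom.comp_apply, Subgroup.coe_subtype, OneMemClass.coe_eq_one]

/-- The linear form `v ↦ 2 (v, α₁) / (α₁, α₁)`. -/
def level : V →ₗ[ℝ] ℝ := (2 / R.form D.α₁ D.α₁) • LinearMap.flip R.form D.α₁

@[simp] theorem level_α₁ : D.level D.α₁ = 2 := by
  have := D.form_α₁_ne_zero
  simp only [level, LinearMap.smul_apply, LinearMap.flip_apply, smul_eq_mul]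
  field_simp

@[simp] theorem level_radical (s : R.radical) : D.level s = 0 := by
  simp [level]

/-- The projection onto the radical along the complement. -/
abbrev pr : V →ₗ[ℝ] R.radical := Submodule.projectionOnto R.radical D.C D.isCompl.symm

theorem pr_shift (s : R.radical) : D.pr (D.α₁ + s) = s := by
  rw [map_add, Submodule.projectionOnto_apply_left,
    Submodule.projectionOnto_apply_of_mem_right _ D.α₁_mem, zero_add]

theorem act_xHat (s : D.S) (v : V) (f : Dual ℝ R.radical) :
    D.act (D.xHat s) (v, f) =
      (v - (D.level v + 2 / R.form D.α₁ D.α₁ * f s) • (D.α₁ + (s : R.radical)), f) := by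
  have h1 : D.act (D.xHat s) = w D.isCompl (D.shiftRoot s) := psi_wHat _ _
  have h2 : extForm D.isCompl (v, f) ((D.shiftRoot s).1, 0) = R.form v D.α₁ + f s := by
    have h : D.pr (D.shiftRoot s).1 = s := D.pr_shift s
    rw [extForm_apply, h]
    simp only [shiftRoot, LinearMap.zero_apply, add_zero, map_add, form_radical_right]
  have h3 : extForm D.isCompl ((D.shiftRoot s).1, 0) ((D.shiftRoot s).1, 0) =
      R.form D.α₁ D.α₁ := by
    rw [extForm_apply]
    simp only [LinearMap.zero_apply, add_zero]
    exact D.form_add_add _ _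
  rw [h1, w, refl_apply, h2, h3]
  ext1
  · simp only [Prod.fst_sub, Prod.smul_fst, level, LinearMap.smul_apply, LinearMap.flip_apply,
      smul_eq_mul, shiftRoot]
    congr 2
    ring
  · simp

theorem act_snd (g : R.WHat) (q : R.HypExt) : (D.act g q).2 = q.2 := by
  have hg : g ∈ Subgroup.closure (Set.range D.xHat) := by
    rw [closure_range_xHat]; trivial
  induction hg using Subgroup.closure_induction generalizing q with
  | mem x hx =>
    obtain ⟨s, rfl⟩ := hx
    rw [← Prod.mk.eta (p := q), act_xHat]
  | one => rw [map_one]; rfl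
  | mul x y _ _ hx hy => rw [map_mul, LinearEquiv.mul_apply, hx, hy]
  | inv x _ hx =>
    rw [← hx, ← LinearEquiv.mul_apply, ← map_mul, mul_inv_cancel, map_one]
    rfl

theorem act_eq (g : R.WHat) (v : V) (f : Dual ℝ R.radical) :
    D.act g (v, f) = ((D.act g (v, f)).1, f) :=
  Prod.ext rfl (D.act_snd g (v, f))

/-- The action of `Ŵ` on `V`. -/
def toEnd : R.WHat →* Module.End ℝ V where
  toFun g := LinearMap.fst ℝ _ _ ∘ₗ (D.act g).toLinearMap ∘ₗ LinearMap.inl ℝ _ _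
  map_one' := by rw [map_one]; rfl
  map_mul' g h := by
    ext v
    simp only [LinearMap.comp_apply, LinearMap.inl_apply, LinearMap.fst_apply, map_mul,
      Module.End.mul_apply, LinearEquiv.coe_coe, LinearEquiv.mul_apply]
    -- The dual coordinate is fixed by `Ŵ`, so `V × 0` is stable and restriction to it is
    -- multiplicative.
    rw [← act_eq]

theorem toEnd_apply (g : R.WHat) (v : V) : D.toEnd g v = (D.act g (v, 0)).1 := rfl

/-- The maps `v ↦ v + 2 (v, α₁) / (α₁, α₁) l`, for `l` in the radical. -/
def shear : Multiplicative R.radical →* Module.End ℝ V where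
  toFun l := LinearMap.id + D.level.smulRight ((Multiplicative.toAdd l : R.radical) : V)
  map_one' := by ext; simp
  map_mul' l m := by
    ext v
    simp
    module

theorem shear_apply (l : R.radical) (v : V) :
    D.shear (Multiplicative.ofAdd l) v = v + D.level v • (l : V) := rfl

theorem toEnd_xHat (s : D.S) (v : V) :
    D.toEnd (D.xHat s) v = v - D.level v • (D.α₁ + (s : R.radical)) := by
  rw [toEnd_apply, act_xHat]
  simp

theorem toEnd_xHat_mul_xHat (s t : D.S) :
    D.toEnd (D.xHat s * D.xHat t) = D.shear (Multiplicative.ofAdd ((s : R.radical) - t)) := by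
  ext v
  rw [map_mul, Module.End.mul_apply, toEnd_xHat, toEnd_xHat, shear_apply]
  simp only [map_sub, map_smul, map_add, level_α₁, level_radical, smul_eq_mul]
  push_cast
  module

theorem toEnd_tHat (r : Fin ν) : D.toEnd (D.tHat r) = D.shear (Multiplicative.ofAdd (D.σ r)) := by
  rw [tHat_eq, toEnd_xHat_mul_xHat]
  simp [tau_empty, tau_singleton]

theorem toEnd_tHat_inv (r : Fin ν) :
    D.toEnd (D.tHat r)⁻¹ = D.shear (Multiplicative.ofAdd (-D.σ r)) := by
  rw [tHat_eq, mul_inv_rev, xHat_inv, xHat_inv, toEnd_xHat_mul_xHat]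
  simp [tau_empty, tau_singleton]

theorem toEnd_list_prod (L : List (Fin ν)) :
    D.toEnd (L.map D.tHat).prod = D.shear (Multiplicative.ofAdd (L.map D.σ).sum) := by
  induction L with
  | nil => simp
  | cons r L ih => simp [toEnd_tHat, ih]

/-- On `V` a product `x_s x_t` is only the shear by `s - t`, and the shears attached to each
generator of `Ẑ` sum to zero. -/
theorem toEnd_of_mem_ZHat {g : R.WHat} (hg : g ∈ D.ZHat) : D.toEnd g = 1 := by
  suffices h : D.ZHat ≤ D.toEnd.ker from MonoidHom.mem_ker.1 (h hg)
  rw [ZHat, Subgroup.closure_le]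
  rintro _ ⟨J, rfl⟩
  rw [SetLike.mem_coe, MonoidHom.mem_ker]
  by_cases hJ : J ∈ supp D.S D.σ
  · rw [zHat_of_mem D hJ, map_mul, toEnd_xHat_mul_xHat, toEnd_list_prod, sum_map_sort, ← map_mul,
      ← ofAdd_add]
    simp [tau_empty]
  · by_cases h2 : J.card = 2
    · obtain ⟨r, s, hrs, rfl⟩ := pair_of_card_eq_two h2
      rw [zHat_pair_of_notMem D hrs hJ, comm]
      simp only [map_mul, toEnd_tHat, toEnd_tHat_inv]
      simp only [← map_mul, ← ofAdd_add]
      rw [show D.σ r + D.σ s + -D.σ r + -D.σ s = 0 by abel]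
      simp
    · rw [zHat_of_notMem_of_card D hJ h2, map_one]

/-- Since `g` fixes `(v, 0)`, linearity reduces its action to the vectors `(0, f)`. Composition in
`Ẑ` thereby becomes addition, which makes `rho` a homomorphism. -/
theorem act_of_mem_ZHat {g : R.WHat} (hg : g ∈ D.ZHat) (v : V) (f : Dual ℝ R.radical) :
    D.act g (v, f) = (v + (D.act g (0, f)).1, f) := by
  have h : D.act g (v, 0) = (v, 0) := by
    rw [act_eq, ← toEnd_apply, toEnd_of_mem_ZHat D hg]; rfl
  have e : ((v, f) : R.HypExt) = (v, 0) + (0, f) := by simp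
  conv_lhs => rw [e, map_add, h, act_eq D g 0 f, Prod.mk_add_mk, zero_add]

/-- The homomorphism that maps `g` in `Ẑ` to the function `f ↦ g (0, f) - (0, f)`. -/
def rho : D.ZHat →* Multiplicative (Dual ℝ R.radical → V) where
  toFun g := Multiplicative.ofAdd fun f => (D.act g.1 (0, f)).1
  map_one' := by
    rw [Subgroup.coe_one, map_one]; rfl
  map_mul' g h := by
    apply Multiplicative.toAdd.injective
    funext f
    have := D.act_of_mem_ZHat g.2 (D.act h.1 (0, f)).1 f
    simp only [toAdd_ofAdd, toAdd_mul, Pi.add_apply]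
    rw [Subgroup.coe_mul, map_mul, LinearEquiv.mul_apply, act_eq D h.1, this, add_comm]

theorem rho_apply (g : D.ZHat) (f : Dual ℝ R.radical) :
    (D.rho g).toAdd f = (D.act g.1 (0, f)).1 := rfl

theorem rho_eq_one_iff (g : D.ZHat) : D.rho g = 1 ↔ g.1 ∈ (psi D.isCompl).ker := by
  rw [mem_ker_psi_iff]
  constructor
  · intro h
    ext1 ⟨v, f⟩
    rw [act_of_mem_ZHat D g.2, ← rho_apply, h]
    simp
  · intro h
    apply Multiplicative.toAdd.injective
    funext f
    rw [rho_apply, h]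
    rfl

/-- The target of `rho` is the additive group of a real vector space, hence torsion-free. -/
theorem mem_ker_psi_of_pow_eq_one {g : D.ZHat} {n : ℕ} (hn : n ≠ 0) (h : g ^ n = 1) :
    g.1 ∈ (psi D.isCompl).ker := by
  rw [← rho_eq_one_iff]
  have h1 := congrArg D.rho h
  rw [map_pow, map_one] at h1
  apply Multiplicative.toAdd.injective
  funext f
  have h2 := congrFun (congrArg Multiplicative.toAdd h1) f
  rw [toAdd_pow, Pi.smul_apply, ← Nat.cast_smul_eq_nsmul ℝ] at h2
  exact (smul_eq_zero.1 h2).resolve_left (by exact_mod_cast hn)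

theorem act_tHat (r : Fin ν) (v : V) (f : Dual ℝ R.radical) :
    D.act (D.tHat r) (v, f) = (v + D.level v • (D.σ r : V) -
      (2 / R.form D.α₁ D.α₁ * f (D.σ r)) • (D.α₁ + (D.σ r : V)), f) := by
  rw [tHat_eq, map_mul, LinearEquiv.mul_apply, act_xHat, act_xHat]
  simp only [coe_tauS, tau_empty, tau_singleton, map_sub, map_smul, level_α₁, map_zero,
    smul_eq_mul, ZeroMemClass.coe_zero, mul_zero, add_zero]
  congr 1
  module

theorem rho_c {r s : Fin ν} (h : r < s) (f : Dual ℝ R.radical) :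
    (D.rho (D.c r s)).toAdd f =
      (((4 / R.form D.α₁ D.α₁) • (f (D.σ r) • D.σ s - f (D.σ s) • D.σ r) : R.radical) : V) := by
  rw [rho_apply, coe_c D h]
  -- In this form only the explicit action of the `t̂_r`, not of their inverses, is needed.
  have h1 : D.comm r s * (D.tHat s * D.tHat r) = D.tHat r * D.tHat s := by
    rw [comm]; group
  have h2 := congrArg (fun g => (D.act g (0, f)).1) h1
  simp only [map_mul, LinearEquiv.mul_apply, act_tHat] at h2
  rw [act_of_mem_ZHat D (D.comm_mem_ZHat h), ← eq_sub_iff_add_eq'] at h2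
  rw [h2]
  simp only [map_sub, map_smul, map_add, level_α₁, map_zero, level_radical, smul_eq_mul]
  push_cast
  module

/-- Evaluating at the dual vector of `σ_{q.2}` and taking the `σ_{q.1}`-coordinate leaves only `-4
E_q / (α₁,α₁)`. -/
theorem eq_zero_of_prod_c_mem_ker (E : Pairs ν → ℤ)
    (h : (∏ p : Pairs ν, D.c p.1.1 p.1.2 ^ E p : D.ZHat).1 ∈ (psi D.isCompl).ker) : E = 0 := by
  classical
  rw [← rho_eq_one_iff, map_prod] at h
  funext q
  have h1 := congrFun (congrArg Multiplicative.toAdd h) (D.σ.coord q.1.2)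
  rw [toAdd_prod, Finset.sum_apply] at h1
  have h2 : ∑ p : Pairs ν, E p • ((4 / R.form D.α₁ D.α₁) •
      (D.σ.coord q.1.2 (D.σ p.1.1) • D.σ p.1.2 - D.σ.coord q.1.2 (D.σ p.1.2) • D.σ p.1.1)) = 0 := by
    apply Subtype.ext
    rw [ZeroMemClass.coe_zero, ← show _ = (0 : V) from h1, AddSubmonoidClass.coe_finsetSum]
    refine Finset.sum_congr rfl fun p _ => ?_
    rw [map_zpow, toAdd_zpow, Pi.smul_apply, rho_c D p.2]
    rfl
  have h3 := congrArg (D.σ.coord q.1.1) h2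
  rw [map_sum, Finset.sum_eq_single q] at h3
  · simp [q.2.ne', D.form_α₁_ne_zero] at h3
    exact h3
  · intro p _ hp
    have hp1 : ¬ (p.1.1 = q.1.1 ∧ p.1.2 = q.1.2) := fun e => hp (Subtype.ext (Prod.ext e.1 e.2))
    -- The transposed pair, which would also contribute, is excluded by the ordering.
    have hp2 : ¬ (p.1.1 = q.1.2 ∧ p.1.2 = q.1.1) := fun e => by
      have := p.2
      rw [e.1, e.2] at this
      exact this.not_gt q.2
    have hc : ∀ i j, D.σ.coord i (D.σ j) = if j = i then 1 else 0 := fun i j => by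
      simp [Finsupp.single_apply]
    simp only [map_zsmul, map_smul, map_sub, hc, smul_eq_mul]
    rw [ite_zero_mul_ite_zero, ite_zero_mul_ite_zero, if_neg hp2, if_neg (fun e => hp1 e.symm),
      sub_zero, mul_zero, smul_zero]
  · simp

/-! ### The quotient `Ŵ ⧸ Ẑ` and its action on `V` -/

theorem mk_tHat_commute (r s : Fin ν) :
    Commute (D.tHat r : R.WHat ⧸ D.ZHat) (D.tHat s : R.WHat ⧸ D.ZHat) := by
  have key : ∀ r s : Fin ν, r < s →
      Commute (D.tHat r : R.WHat ⧸ D.ZHat) (D.tHat s : R.WHat ⧸ D.ZHat) := by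
    intro r s h
    have h1 := (QuotientGroup.eq_one_iff _).2 (D.comm_mem_ZHat h)
    rw [comm, QuotientGroup.mk_mul, QuotientGroup.mk_inv, mul_inv_eq_one, QuotientGroup.mk_mul,
      QuotientGroup.mk_inv, mul_inv_eq_iff_eq_mul, QuotientGroup.mk_mul] at h1
    exact h1
  rcases lt_trichotomy r s with h | rfl | h
  · exact key r s h
  · rfl
  · exact (key s r h).symm

/-- The homomorphism `ℤ^ν → Ŵ ⧸ Ẑ` that maps the `r`-th basis vector to the class of `t̂_r`. -/
def phi : (Fin ν → Multiplicative ℤ) →* R.WHat ⧸ D.ZHat :=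
  MonoidHom.noncommPiCoprod (fun r => zpowersHom (R.WHat ⧸ D.ZHat) (D.tHat r))
    (fun r s _ x y => by
      simp only [zpowersHom_apply]
      exact (D.mk_tHat_commute r s).zpow_zpow _ _)

theorem phi_mulSingle (r : Fin ν) (n : Multiplicative ℤ) :
    D.phi (Pi.mulSingle r n) = (D.tHat r : R.WHat ⧸ D.ZHat) ^ n.toAdd := by
  exact MonoidHom.noncommPiCoprod_mulSingle (N := fun _ => Multiplicative ℤ) _ r n

theorem mk_tHat_mem_range (r : Fin ν) : (D.tHat r : R.WHat ⧸ D.ZHat) ∈ D.phi.range :=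
  ⟨Pi.mulSingle r (Multiplicative.ofAdd 1), by rw [phi_mulSingle]; simp⟩

/-- Conjugation by `x_0` inverts every `t̂_r`. This makes the elements `phi n` and `x_0 * phi n`
closed under multiplication, as in a generalized dihedral group. -/
theorem mk_zeroS_conj_phi (n : Fin ν → Multiplicative ℤ) :
    (D.xHat D.zeroS : R.WHat ⧸ D.ZHat) * D.phi n * (D.xHat D.zeroS : R.WHat ⧸ D.ZHat)⁻¹ =
      D.phi n⁻¹ := by
  have : (MulAut.conj (D.xHat D.zeroS : R.WHat ⧸ D.ZHat)).toMonoidHom.comp D.phi =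
      D.phi.comp (invMonoidHom) := by
    refine MonoidHom.pi_ext fun r x => ?_
    simp only [MonoidHom.comp_apply, invMonoidHom_apply, ← Pi.mulSingle_inv, phi_mulSingle,
      MulEquiv.coe_toMonoidHom, map_zpow, MulAut.conj_apply, toAdd_inv, zpow_neg]
    rw [← inv_zpow, ← QuotientGroup.mk_inv D.ZHat (D.tHat r), ← xHat_zeroS_conj_tHat,
      ← QuotientGroup.mk_inv, xHat_inv]
    rfl
  exact DFunLike.congr_fun this n

/-- The subgroup generated by the classes of `ŵ_{α₁}` and of the `t̂_r`. -/
def basicSubgroup : Subgroup (R.WHat ⧸ D.ZHat) where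
  carrier := {q | ∃ n, q = D.phi n ∨ q = D.xHat D.zeroS * D.phi n}
  one_mem' := ⟨1, Or.inl (map_one _).symm⟩
  mul_mem' := by
    have hx : (D.xHat D.zeroS : R.WHat ⧸ D.ZHat)⁻¹ = D.xHat D.zeroS := by
      rw [← QuotientGroup.mk_inv, xHat_inv]
    have h : ∀ n, D.phi n * (D.xHat D.zeroS : R.WHat ⧸ D.ZHat) =
        D.xHat D.zeroS * D.phi n⁻¹ := fun n => by
      rw [← mk_zeroS_conj_phi, ← mul_assoc, ← mul_assoc]
      nth_rewrite 2 [← hx]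
      rw [inv_mul_cancel, one_mul, hx]
    rintro _ _ ⟨n, rfl | rfl⟩ ⟨m, rfl | rfl⟩
    · exact ⟨n * m, Or.inl (map_mul _ _ _).symm⟩
    · exact ⟨n⁻¹ * m, Or.inr (by rw [← mul_assoc, h, map_mul, mul_assoc])⟩
    · exact ⟨n * m, Or.inr (by rw [map_mul, mul_assoc])⟩
    · refine ⟨n⁻¹ * m, Or.inl ?_⟩
      rw [map_mul, ← mk_zeroS_conj_phi, hx]
      simp only [mul_assoc]
  inv_mem' := by
    rintro _ ⟨n, rfl | rfl⟩
    · exact ⟨n⁻¹, Or.inl (map_inv _ _).symm⟩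
    · refine ⟨n, Or.inr ?_⟩
      rw [mul_inv_rev, ← map_inv, ← mk_zeroS_conj_phi, mul_assoc, ← mul_inv_rev,
        ← QuotientGroup.mk_mul, xHat_mul_self, QuotientGroup.mk_one, inv_one, mul_one]

theorem mk_zeroS_mem : (D.xHat D.zeroS : R.WHat ⧸ D.ZHat) ∈ D.basicSubgroup :=
  ⟨1, Or.inr (by rw [map_one, mul_one])⟩

theorem mk_tHat_mem (r : Fin ν) : (D.tHat r : R.WHat ⧸ D.ZHat) ∈ D.basicSubgroup := by
  obtain ⟨n, hn⟩ := D.mk_tHat_mem_range r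
  exact ⟨n, Or.inl hn.symm⟩

theorem mk_tau_mem (J : Finset (Fin ν)) (hJ : J ∈ supp D.S D.σ) :
    (D.xHat (D.tauS J hJ) : R.WHat ⧸ D.ZHat) ∈ D.basicSubgroup := by
  rw [xHat_eq_of_mem, QuotientGroup.mk_mul, QuotientGroup.mk_mul,
    (QuotientGroup.eq_one_iff (D.zHat J)).2 (D.z J).2, one_mul]
  refine mul_mem D.mk_zeroS_mem ?_
  rw [QuotientGroup.mk_inv]
  refine inv_mem ?_
  change QuotientGroup.mk' D.ZHat _ ∈ _
  rw [map_list_prod]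
  refine list_prod_mem fun x hx => ?_
  obtain ⟨y, hy, rfl⟩ := List.mem_map.1 hx
  obtain ⟨r, -, rfl⟩ := List.mem_map.1 hy
  exact D.mk_tHat_mem r

/-- As the `σ_r` span `Λ`, some word in the `t̂_r` translates by `l`; conjugating by it carries
`x_s` to `x_t`. -/
theorem mk_shift_mem {l : R.radical} (hl : l ∈ Submodule.span ℤ D.S) (s t : D.S)
    (h : (t : R.radical) = s + (2 : ℤ) • l)
    (hs : (D.xHat s : R.WHat ⧸ D.ZHat) ∈ D.basicSubgroup) :
    (D.xHat t : R.WHat ⧸ D.ZHat) ∈ D.basicSubgroup := by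
  have : ∃ g : R.WHat, D.ConjTranslates g l ∧ (g : R.WHat ⧸ D.ZHat) ∈ D.basicSubgroup := by
    rw [D.span_int_eq, ← Submodule.mem_toAddSubgroup,
      Submodule.span_int_eq_addSubgroupClosure] at hl
    clear h
    induction hl using AddSubgroup.closure_induction with
    | mem x hx =>
      obtain ⟨r, rfl⟩ := hx
      exact ⟨D.tHat r, ConjTranslates.tHat D r, D.mk_tHat_mem r⟩
    | zero => exact ⟨1, ConjTranslates.one, one_mem _⟩
    | add x y _ _ hx hy =>
      obtain ⟨g, hg, hg'⟩ := hx
      obtain ⟨h, hh, hh'⟩ := hy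
      exact ⟨g * h, hg.mul hh, mul_mem hg' hh'⟩
    | neg x _ hx =>
      obtain ⟨g, hg, hg'⟩ := hx
      exact ⟨g⁻¹, hg.inv, inv_mem hg'⟩
  obtain ⟨g, hg, hg'⟩ := this
  rw [← hg.2 s t h]
  exact mul_mem (mul_mem hg' hs) (inv_mem hg')

theorem mk_mem_basicSubgroup (g : R.WHat) : (g : R.WHat ⧸ D.ZHat) ∈ D.basicSubgroup := by
  suffices h : (⊤ : Subgroup R.WHat) ≤ D.basicSubgroup.comap (QuotientGroup.mk' D.ZHat) from
    h (Subgroup.mem_top g)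
  rw [← D.closure_range_xHat, Subgroup.closure_le]
  rintro _ ⟨s, rfl⟩
  obtain ⟨s, hs⟩ := s
  have hs' := hs
  rw [(eq_supp_iff D.isSemilattice D.σ D.span_int_eq _).1 rfl] at hs
  simp only [Set.mem_iUnion] at hs
  obtain ⟨J, hJ, l, hl, e⟩ := hs
  exact D.mk_shift_mem hl (D.tauS J hJ) ⟨s, hs'⟩ e (D.mk_tau_mem J hJ)

/-- The action of `Ŵ ⧸ Ẑ` on `V`. -/
def quotToEnd : R.WHat ⧸ D.ZHat →* Module.End ℝ V :=
  QuotientGroup.lift D.ZHat D.toEnd fun _ hg => D.toEnd_of_mem_ZHat hg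

theorem quotToEnd_mk (g : R.WHat) : D.quotToEnd (g : R.WHat ⧸ D.ZHat) = D.toEnd g := rfl

theorem quotToEnd_phi (n : Fin ν → Multiplicative ℤ) :
    D.quotToEnd (D.phi n) = D.shear (Multiplicative.ofAdd (∑ r, (n r).toAdd • D.σ r)) := by
  let F : (Fin ν → Multiplicative ℤ) →* Module.End ℝ V := D.shear.comp
    { toFun := fun n => Multiplicative.ofAdd (∑ r, (n r).toAdd • D.σ r)
      map_one' := by simp
      map_mul' := fun n m => by
        rw [← ofAdd_add, ← Finset.sum_add_distrib]
        simp only [Pi.mul_apply, toAdd_mul, add_smul] }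
  have : D.quotToEnd.comp D.phi = F := by
    refine MonoidHom.pi_ext fun r x => ?_
    have h : F (Pi.mulSingle r x) = D.shear (Multiplicative.ofAdd (x.toAdd • D.σ r)) := by
      change D.shear (Multiplicative.ofAdd _) = _
      congr 2
      rw [Finset.sum_eq_single r]
      · simp
      · intro s _ hs
        simp [Pi.mulSingle_eq_of_ne hs]
      · simp
    have h2 : D.quotToEnd.comp (zpowersHom _ (D.tHat r : R.WHat ⧸ D.ZHat)) =
        D.shear.comp (zpowersHom _ (Multiplicative.ofAdd (D.σ r))) := by
      refine MonoidHom.ext_mint ?_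
      simp [quotToEnd_mk, toEnd_tHat]
    rw [h, MonoidHom.comp_apply, phi_mulSingle]
    exact DFunLike.congr_fun h2 x
  exact DFunLike.congr_fun this n

theorem ker_psi_le_ZHat : (psi D.isCompl).ker ≤ D.ZHat := by
  intro g hg
  rw [mem_ker_psi_iff] at hg
  have h1 : D.toEnd g D.α₁ = D.α₁ := by rw [toEnd_apply, hg]; rfl
  rw [← QuotientGroup.eq_one_iff]
  rw [← quotToEnd_mk] at h1
  obtain ⟨n, hn | hn⟩ := D.mk_mem_basicSubgroup g
  -- Here `α₁` goes to `α₁ + 2 ∑ n_r σ_r`, so all `n_r` vanish.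
  · rw [hn, quotToEnd_phi, shear_apply, level_α₁, add_eq_left, smul_eq_zero_iff_right two_ne_zero,
      ZeroMemClass.coe_eq_zero] at h1
    have h2 : n = 1 := by
      funext r
      have h3 := congrArg (D.σ.coord r) h1
      simpa [Finsupp.single_apply] using h3
    rw [hn, h2, map_one]
  -- Here the image of `α₁` has level `-2`, whereas `α₁` has level `2`.
  · rw [hn, map_mul, quotToEnd_mk, quotToEnd_phi, Module.End.mul_apply, toEnd_xHat, shear_apply] at h1
    have h2 := congrArg D.level h1
    simp only [map_sub, map_smul, map_add, level_α₁, level_radical, smul_eq_mul] at h2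
    norm_num at h2

/-! ### Sign characters and uniqueness of `ε` -/

theorem tau_injective_mod_two {J K : Finset (Fin ν)} {l : R.radical}
    (hl : l ∈ Submodule.span ℤ D.S) (h : tau D.σ J = tau D.σ K + (2 : ℤ) • l) : J = K := by
  rw [D.span_int_eq, Submodule.mem_span_range_iff_exists_fun] at hl
  obtain ⟨c, rfl⟩ := hl
  ext i
  have hi := congrArg (fun v => D.σ.repr v i) h
  have h3 : (if i ∈ J then 1 else 0 : ℤ) = (if i ∈ K then 1 else 0) + 2 * c i := by
    have : ((if i ∈ J then 1 else 0 : ℤ) : ℝ) = ((if i ∈ K then 1 else 0) + 2 * c i : ℤ) := by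
      simpa [tau, Finsupp.single_apply] using hi
    exact_mod_cast this
  by_cases h1 : i ∈ J <;> by_cases h2 : i ∈ K <;> simp only [h1, h2, if_true, if_false] at h3 ⊢
  · omega
  · omega

open Classical in
/-- The sign of a root `α` with respect to `K`: it is `-1` if the radical part of `α` is in
`τ_K + 2Λ`. -/
def sign (K : Finset (Fin ν)) (α : R.NonIso) : ℤˣ :=
  if ∃ l ∈ Submodule.span ℤ D.S, D.pr α.1 = tau D.σ K + (2 : ℤ) • l then -1 else 1

/-- All Cartan integers between non-isotropic roots are `±2`, so a reflection changes the radical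
part only by an element of `2Λ`. The signs are therefore constant under reflections and define
characters. -/
theorem exists_coroot_smul_eq (α β : R.NonIso) : ∃ l ∈ Submodule.span ℤ D.S,
    D.pr ((2 * R.form β.1 α.1 / R.form α.1 α.1) • α.1) = (2 : ℤ) • l := by
  have key : ∀ α : R.NonIso, ∃ s ∈ D.S, α.1 = D.α₁ + (s : V) ∨ α.1 = -(D.α₁ + (s : V)) := by
    rintro ⟨α, h1, h2⟩
    rw [D.roots_eq] at h1
    rcases h1 with ⟨s, -, t, -, rfl⟩ | ⟨s, hs, h | h⟩
    · rw [map_add, form_radical_right, form_radical_right] at h2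
      simp at h2
    · exact ⟨s, hs, Or.inl h⟩
    · refine ⟨-s, ?_, Or.inr (by simp [h, add_comm])⟩
      have := D.isSemilattice.sub_two_smul_mem s hs s hs
      rwa [two_smul, sub_add_cancel_left] at this
  obtain ⟨s, hs, h⟩ := key α
  obtain ⟨t, ht, h'⟩ := key β
  have h0 := D.form_α₁_ne_zero
  have hs' := Submodule.subset_span (R := ℤ) hs
  have e : 2 * R.form D.α₁ D.α₁ / R.form D.α₁ D.α₁ = 2 := by field_simp
  rcases h with h | h <;> rcases h' with h' | h' <;>
    simp only [h, h', map_neg, LinearMap.neg_apply, neg_neg, form_add_add, mul_neg, neg_div,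
      e, map_smul, neg_smul, smul_neg, pr_shift]
  · exact ⟨s, hs', by module⟩
  · exact ⟨-s, neg_mem hs', by module⟩
  · exact ⟨s, hs', by module⟩
  · exact ⟨-s, neg_mem hs', by module⟩

theorem sign_reflect (K : Finset (Fin ν)) (α β γ : R.NonIso)
    (h : γ.1 = β.1 - (2 * R.form β.1 α.1 / R.form α.1 α.1) • α.1) :
    D.sign K γ = D.sign K β := by
  obtain ⟨m, hm, e⟩ := D.exists_coroot_smul_eq α β
  rw [sign, sign, h, map_sub, e]
  congr 1
  refine propext ⟨?_, ?_⟩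
  · rintro ⟨l, hl, h⟩
    exact ⟨l + m, add_mem hl hm, by rw [smul_add, ← add_assoc, ← h, sub_add_cancel]⟩
  · rintro ⟨l, hl, h⟩
    exact ⟨l - m, sub_mem hl hm, by rw [h, smul_sub, add_sub_assoc]⟩

/-- The character of `Ŵ` that maps `ŵ_α` to the sign of `α` with respect to `K`. -/
def chi (K : Finset (Fin ν)) : R.WHat →* ℤˣ :=
  PresentedGroup.toGroup (f := D.sign K) (by
    rintro x (⟨α, rfl⟩ | ⟨α, β, γ, h, rfl⟩)
    · rw [map_pow, Int.units_sq]
    · simp only [map_mul, map_inv, FreeGroup.lift_apply_of]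
      rw [sign_reflect D K α β γ h, mul_comm (D.sign K α), mul_assoc (D.sign K β),
        Int.units_mul_self, mul_one, mul_inv_cancel])

theorem chi_tau (K J : Finset (Fin ν)) (hJ : J ∈ supp D.S D.σ) :
    D.chi K (D.xHat (D.tauS J hJ)) = if J = K then -1 else 1 := by
  have h : D.chi K (D.xHat (D.tauS J hJ)) = D.sign K (D.shiftRoot (D.tauS J hJ)) :=
    PresentedGroup.toGroup.of _
  rw [h, sign]
  have e : D.pr (D.shiftRoot (D.tauS J hJ)).1 = tau D.σ J := D.pr_shift _
  rw [e]
  congr 1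
  refine propext ⟨?_, ?_⟩
  · rintro ⟨l, hl, h⟩
    exact D.tau_injective_mod_two hl h
  · rintro rfl
    exact ⟨0, zero_mem _, by simp⟩

variable {D} in
theorem chi_tHat {K : Finset (Fin ν)} (hK : 3 ≤ K.card) (r : Fin ν) : D.chi K (D.tHat r) = 1 := by
  rw [tHat_eq, map_mul, chi_tau, chi_tau, if_neg, if_neg, one_mul]
  · rintro rfl
    simp at hK
  · rintro rfl
    simp at hK

variable {D} in
-- As `K` has at least three elements, `χ_K` is trivial on `x_0` and on every `t̂_r`; only the
-- factor `x_{τ_J}` can contribute a sign.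
theorem chi_zHat {K J : Finset (Fin ν)} (hK : K ∈ Esupp D.S D.σ) :
    D.chi K (D.zHat J) = if J = K then -1 else 1 := by
  by_cases hJ : J ∈ supp D.S D.σ
  · have h0 : (∅ : Finset (Fin ν)) ≠ K := by
      rintro rfl
      simpa using hK.2
    rw [zHat_of_mem D hJ, map_mul, map_mul, chi_tau, chi_tau, if_neg h0, one_mul, map_list_prod,
      List.prod_eq_one, mul_one]
    intro x hx
    obtain ⟨y, hy, rfl⟩ := List.mem_map.1 hx
    obtain ⟨r, -, rfl⟩ := List.mem_map.1 hy
    exact chi_tHat hK.2 r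
  · rw [if_neg (by rintro rfl; exact hJ hK.1)]
    by_cases h2 : J.card = 2
    · obtain ⟨r, s, hrs, rfl⟩ := pair_of_card_eq_two h2
      rw [zHat_pair_of_notMem D hrs hJ, comm]
      simp [chi_tHat hK.2]
    · rw [zHat_of_notMem_of_card D hJ h2, map_one]

theorem chi_u (K : Esupp D.S D.σ) (m : Pairs ν → ℤ) (ε : Collection D.S D.σ) :
    D.chi K.1 (D.u m ε) = (-1) ^ (ε K : ℕ) := by
  classical
  rw [u, Subgroup.coe_mul, map_mul, ← Subgroup.coe_subtype, ← MonoidHom.comp_apply,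
    ← MonoidHom.comp_apply, map_prod, map_prod, Finset.prod_eq_one, one_mul,
    Finset.prod_eq_single K]
  · simp [chi_zHat K.2]
  · intro J _ hJ
    simp [chi_zHat K.2, Subtype.coe_ne_coe.2 hJ]
  · simp
  · intro p _
    have : ({p.1.1, p.1.2} : Finset (Fin ν)) ≠ K.1 := fun e => by
      have h3 := K.2.2
      rw [← e] at h3
      have := Finset.card_le_two (a := p.1.1) (b := p.1.2)
      omega
    simp [chi_zHat K.2, this]

theorem collection_eq_of_u_eq {m m' : Pairs ν → ℤ} {ε ε' : Collection D.S D.σ}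
    (h : D.u m ε = D.u m' ε') : ε = ε' := by
  funext K
  have h1 := congrArg (fun x : D.ZHat => D.chi K.1 x) h
  simp only [chi_u] at h1
  generalize ε K = a at h1
  generalize ε' K = b at h1
  revert h1
  revert a b
  decide

end A1Data

end EAWG

end

/-! ### Assembly of the proposition -/

theorem mainTheorem2 {V : Type*} [AddCommGroup V] [Module ℝ V] [FiniteDimensional ℝ V]
    [TopologicalSpace V] [IsTopologicalAddGroup V] [ContinuousSMul ℝ V] [T2Space V]
    (R : EAWG.EARS V) {ν : ℕ} (D : EAWG.A1Data R ν) :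
    D.ZHat ≤ Subgroup.center R.WHat ∧
    (EAWG.EARS.psi D.isCompl).ker ≤ D.ZHat ∧
    (∀ u ∈ D.ZHat, List.TFAE [
      u ∈ (EAWG.EARS.psi D.isCompl).ker,
      u ^ 2 = 1,
      IsOfFinOrder u,
      ∃ (m : EAWG.Pairs ν → ℤ) (ε : EAWG.Collection D.S D.σ),
        EAWG.IsIntegralCollection D.S D.σ ε ∧
        (∀ p, (m p : ℚ) = - EAWG.integralSum D.S D.σ ε p) ∧
        u = D.uHat m ε]) ∧
    Set.BijOn (fun ε => D.uHat (EAWG.mOf D.S D.σ ε) ε)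
      {ε | EAWG.IsIntegralCollection D.S D.σ ε}
      ((EAWG.EARS.psi D.isCompl).ker : Set R.WHat) := by
  have tfae : ∀ u ∈ D.ZHat, List.TFAE [
      u ∈ (EAWG.EARS.psi D.isCompl).ker,
      u ^ 2 = 1,
      IsOfFinOrder u,
      ∃ (m : EAWG.Pairs ν → ℤ) (ε : EAWG.Collection D.S D.σ),
        EAWG.IsIntegralCollection D.S D.σ ε ∧
        (∀ p, (m p : ℚ) = - EAWG.integralSum D.S D.σ ε p) ∧
        u = D.uHat m ε] := by
    intro u hu
    tfae_have 1 → 4 := by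
      intro h
      obtain ⟨m, ε, e⟩ := D.exists_eq_u ⟨u, hu⟩
      -- The square of `u` also lies in `ker ψ` and is a product of independent commutators, so all
      -- its exponents are zero.
      have h2 : (∏ p : EAWG.Pairs ν, D.c p.1.1 p.1.2 ^ D.sqExp m ε p : D.ZHat).1 ∈
          (EAWG.EARS.psi D.isCompl).ker := by
        rw [← D.u_sq, ← e]
        exact pow_mem h 2
      have h3 : ∀ p, (m p : ℚ) = - EAWG.integralSum D.S D.σ ε p := fun p =>
        (D.sqExp_eq_zero_iff m ε p).1 (congrFun (D.eq_zero_of_prod_c_mem_ker _ h2) p)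
      refine ⟨m, ε, fun p => ⟨-m p, ?_⟩, h3, ?_⟩
      · rw [Int.cast_neg, h3, neg_neg]
      · rw [← D.coe_u, ← e]
    tfae_have 4 → 2 := by
      rintro ⟨m, ε, -, hm, rfl⟩
      rw [← D.coe_u, ← Subgroup.coe_pow, D.u_sq,
        Finset.prod_eq_one fun p _ => by rw [(D.sqExp_eq_zero_iff m ε p).2 (hm p), zpow_zero]]
      rfl
    tfae_have 2 → 3 := fun h => isOfFinOrder_iff_pow_eq_one.2 ⟨2, two_pos, h⟩
    tfae_have 3 → 1 := by
      intro h
      obtain ⟨n, hn, e⟩ := isOfFinOrder_iff_pow_eq_one.1 h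
      exact D.mem_ker_psi_of_pow_eq_one (g := ⟨u, hu⟩) hn.ne' (Subtype.ext e)
    tfae_finish
  refine ⟨D.ZHat_le_center, D.ker_psi_le_ZHat, tfae, ?_, ?_, ?_⟩
  · intro ε hε
    have hu : D.uHat (EAWG.mOf D.S D.σ ε) ε ∈ D.ZHat := by
      rw [← D.coe_u]
      exact SetLike.coe_mem _
    exact ((tfae _ hu).out 0 3 rfl rfl).2 ⟨_, ε, hε, EAWG.mOf_cast hε, rfl⟩
  · intro ε _ ε' _ h
    simp only [← D.coe_u] at h
    exact D.collection_eq_of_u_eq (Subtype.ext h)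
  · intro u hu
    obtain ⟨m, ε, hε, hm, rfl⟩ := ((tfae u (D.ker_psi_le_ZHat hu)).out 0 3 rfl rfl).1 hu
    refine ⟨ε, hε, ?_⟩
    -- Condition (*) determines `m` from `ε`, so the `m` supplied by (d) is the one used in (iii).
    have : EAWG.mOf D.S D.σ ε = m := by
      funext p
      have h := EAWG.mOf_cast hε p
      rw [← hm p] at h
      exact_mod_cast h
    simp only [this]
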